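/- **Setting.** Let $P$ be a probability distribution on a measurable space $\mathcal X$, let $\psi$ be a real-valued functional of probability distributions on $\mathcal X$, with target $\psi=\psi(P)$, and let $X_1,\dots,X_n$ be i.i.d. from $P$ with empirical distribution $\hat P_n=\frac1n\sum_{i=1}^n\delta_{X_i}$. For $b=1,\dots,B$ let $P_n^{*b}$ be the empirical distribution of the $b$-th resample, obtained by drawing independently and uniformly with replacement $n$ times from $\{X_1,\dots,X_n\}$; the resamples are independent given the data, and $P_n^*$ denotes one of them. Put $\hat\psi_n=\psi(\hat P_n)$, $\psi_n^{*}=\psi(P_n^{*})$. The value $\psi(Q)$ cannot be computed exactly: for an input distribution $Q$ one can only generate independent computation runs $\hat\psi_r(Q)$, $r=1,2,\dots$, with $E[\hat\psi_r(Q)]=\psi(Q)$ (required for $Q=P$ and for every empirical distribution $Q$ of finitely many points). Write $\tau^2(Q)=\mathrm{Var}(\hat\psi_r(Q))$ and $\kappa_3(Q)=E|\hat\psi_r(Q)-\psi(Q)|^3$. With fresh independent runs given the data and the resamples, define $$\hat{\hat\psi}_{n,R_0}=\frac1{R_0}\sum_{r=1}^{R_0}\hat\psi_r(\hat P_n),\qquad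 \psi^{**b}_{n,R}=\frac1R\sum_{r=1}^{R}\hat\psi_r(P_n^{*b}),\quad b=1,\dots,B.$$ **Assumptions.** 1. For some $\sigma^2>0$, $\sqrt n(\hat\psi_n-\psi)\Rightarrow N(0,\sigma^2)$, and for every $x\in\mathbb R$, $\mathbb P(\sqrt n(\psi_n^*-\hat\psi_n)\le x\mid X_1,\dots,X_n)\to \mathbb P(N(0,\sigma^2)\le x)$ in probability, as $n\to\infty$. 2. $0<\tau^2(P)<\infty$, $\kappa_3(P)<\infty$, and, as $n\to\infty$, $\tau^2(\hat P_n)\to\tau^2(P)$, $\kappa_3(\hat P_n)\to\kappa_3(P)$, $\tau^2(P_n^*)\to\tau^2(P)$ and $\kappa_3(P_n^*)\to\kappa_3(P)$ in probability. 3. The computation sizes $R_0=R_0(n)$ and $R=R(n)$ satisfy $R_0/n\to p_0$ and $R/n\to p$ as $n\to\infty$, for constants $0<p_0,p<1$. Put $\rho=\sqrt{p_0/p}$. **Theorem.** Let $B\ge 2$ be a fixed integer and $0<\alpha<1$. Let $$S_M^2=\frac1{B-1}\sum_{b=1}^B\Big(\psi_{n,R}^{**b}-\frac1B\sum_{c=1}^B\psi_{n,R}^{**c}\Big)^2,\qquad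 q_{M,1-\alpha/2}=\max\{\rho^{-1},1\}\,t_{B-1,1-\alpha/2},$$ where $t_{B-1,1-\alpha/2}$ is the $(1-\alpha/2)$-quantile of Student's $t$-distribution with $B-1$ degrees of freedom, and let $$\mathcal I_M=\big[\hat{\hat\psi}_{n,R_0}-q_{M,1-\alpha/2}S_M,\ \hat{\hat\psi}_{n,R_0}+q_{M,1-\alpha/2}S_M\big].$$ Under the assumptions above, $$\liminf_{n\to\infty}\mathbb P_n(\psi\in\mathcal I_M)\ge 1-\alpha,$$ where $\mathbb P_n$ is the probability with respect to the data, the resampling and the computation runs. Moreover, if $\rho=1$, then $$\lim_{n\to\infty}\mathbb P_n(\psi\in\mathcal I_M)=1-\alpha.$$ -/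

import Mathlib

open MeasureTheory ProbabilityTheory Filter Topology
open scoped NNReal ENNReal

noncomputable section

namespace CheapBootstrap

/-! ### Generic probabilistic notions -/

/-- Convergence in probability to a constant `c` of random elements `f i`, where `f i` lives on
its own probability space `(Ω i, μ i)`. -/
def TendstoInProbability {ι E : Type*} [EDist E] {Ω : ι → Type*}
    [∀ i, MeasurableSpace (Ω i)] (μ : ∀ i, Measure (Ω i)) (f : ∀ i, Ω i → E)
    (l : Filter ι) (c : E) : Prop :=
  ∀ ε : ℝ≥0∞, 0 < ε → Tendsto (fun i => μ i {ω | ε ≤ edist (f i ω) c}) l (𝓝 0)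

/-- Student's `t`-distribution with `k` degrees of freedom: the law of `Z / √(Y / k)` with
`Z ∼ N(0,1)` and `Y = V₁² + ⋯ + V_k² ∼ χ²_k` independent. -/
def studentT (k : ℕ) : Measure ℝ :=
  ((gaussianReal 0 1).prod (Measure.pi fun _ : Fin k => gaussianReal 0 1)).map
    (fun zv => zv.1 / √((∑ i, zv.2 i ^ 2) / k))

/-- The `p`-quantile of a distribution on the real line. -/
def quantile (μ : Measure ℝ) (p : ℝ) : ℝ := sInf {q : ℝ | p ≤ μ.real (Set.Iic q)}

/-! ### Data, resamples and computation runs -/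

variable {𝒳 Ξ : Type*} [MeasurableSpace 𝒳] [MeasurableSpace Ξ]

/-- The empirical distribution `(1/n) ∑ δ_{x i}` of a data set of size `n ≥ 1`. -/
def empirical (n : ℕ+) (x : Fin n → 𝒳) : ProbabilityMeasure 𝒳 :=
  ⟨((n : ℕ) : ℝ≥0∞)⁻¹ • ∑ i, Measure.dirac (x i), ⟨by
    have h : ((n : ℕ) : ℝ≥0∞) ≠ 0 := by exact_mod_cast n.ne_zero
    simp [ENNReal.inv_mul_cancel h]⟩⟩

/-- The law of an i.i.d. data set `X₁, …, Xₙ` from `P`. -/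
def dataLaw (P : ProbabilityMeasure 𝒳) (n : ℕ+) : Measure (Fin n → 𝒳) :=
  Measure.pi fun _ => (P : Measure 𝒳)

instance (P : ProbabilityMeasure 𝒳) (n : ℕ+) : IsProbabilityMeasure (dataLaw P n) := by
  unfold dataLaw; infer_instance

/-- The law of the indices of one resample: `n` independent uniform draws (with replacement) from
the `n` data positions. -/
def indexLaw (n : ℕ+) : Measure (Fin n → Fin n) :=
  Measure.pi fun _ => (PMF.uniformOfFintype (Fin n)).toMeasure

instance (n : ℕ+) : IsProbabilityMeasure (indexLaw n) := by
  unfold indexLaw; infer_instance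

/-- The empirical distribution of the resample `x (I 1), …, x (I n)` of the data set `x`. -/
def resampleEmpirical (n : ℕ+) (x : Fin n → 𝒳) (I : Fin n → Fin n) : ProbabilityMeasure 𝒳 :=
  empirical n fun i => x (I i)

/-- `h Q ξ` is the output of one computation run driven by the input distribution `Q`, where `ξ`
is the computation randomness of the run, of law `ν`. This says that the runs at `Q` are unbiased
outputs for `ψ Q`. -/
def UnbiasedAt (ψ : ProbabilityMeasure 𝒳 → ℝ) (h : ProbabilityMeasure 𝒳 → Ξ → ℝ) (ν : Measure Ξ)
    (Q : ProbabilityMeasure 𝒳) : Prop :=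
  Integrable (h Q) ν ∧ ∫ ξ, h Q ξ ∂ν = ψ Q

/-- The variance `τ²(Q)` of a computation run driven by `Q`, possibly infinite. -/
def runVariance (h : ProbabilityMeasure 𝒳 → Ξ → ℝ) (ν : Measure Ξ)
    (Q : ProbabilityMeasure 𝒳) : ℝ≥0∞ :=
  evariance (h Q) ν

/-- The third absolute central moment `κ₃(Q)` of a computation run driven by `Q`, possibly
infinite. -/
def runThirdMoment (ψ : ProbabilityMeasure 𝒳 → ℝ) (h : ProbabilityMeasure 𝒳 → Ξ → ℝ)
    (ν : Measure Ξ) (Q : ProbabilityMeasure 𝒳) : ℝ≥0∞ :=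
  ∫⁻ ξ, ‖h Q ξ - ψ Q‖ₑ ^ 3 ∂ν

/-- A computation procedure: runs driven by empirical distributions are (jointly) measurable in the
data and the computation randomness, and the runs driven by `P` and by every empirical distribution
are unbiased. -/
structure IsComputation (P : ProbabilityMeasure 𝒳) (ψ : ProbabilityMeasure 𝒳 → ℝ)
    (h : ProbabilityMeasure 𝒳 → Ξ → ℝ) (ν : Measure Ξ) : Prop where
  measurable_run : ∀ n : ℕ+,
    Measurable fun xξ : (Fin n → 𝒳) × Ξ => h (empirical n xξ.1) xξ.2
  unbiased : UnbiasedAt ψ h ν P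
  unbiased_empirical : ∀ (n : ℕ+) (x : Fin n → 𝒳), UnbiasedAt ψ h ν (empirical n x)

/-- Standard condition for bootstrap validity: `√n (ψ̂ₙ - ψ) ⇒ N(0, σ²)` and, for one resample
estimate, `√n (ψₙ* - ψ̂ₙ) ⇒ N(0, σ²)` conditionally on the data, in probability. -/
structure BootstrapValid (P : ProbabilityMeasure 𝒳) (ψ : ProbabilityMeasure 𝒳 → ℝ)
    (σ : ℝ≥0) : Prop where
  original : TendstoInDistribution
    (fun (n : ℕ+) (x : Fin n → 𝒳) => √(n : ℝ) * (ψ (empirical n x) - ψ P)) atTop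
    (id : ℝ → ℝ) (fun n => dataLaw P n) (gaussianReal 0 (σ ^ 2))
  resample : ∀ t : ℝ, TendstoInProbability (fun n : ℕ+ => dataLaw P n)
    (fun n x => (indexLaw n).real
      {I | √(n : ℝ) * (ψ (resampleEmpirical n x I) - ψ (empirical n x)) ≤ t})
    atTop ((gaussianReal 0 (σ ^ 2)).real (Set.Iic t))

/-- Moment consistency of computation runs: `0 < τ²(P) < ∞`, `κ₃(P) < ∞`, and `τ²`, `κ₃` at the
empirical distribution and at a resample empirical distribution converge in probability to their
values at `P`. -/
structure MomentConsistent (P : ProbabilityMeasure 𝒳) (ψ : ProbabilityMeasure 𝒳 → ℝ)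
    (h : ProbabilityMeasure 𝒳 → Ξ → ℝ) (ν : Measure Ξ) : Prop where
  variance_pos : 0 < runVariance h ν P
  variance_lt_top : runVariance h ν P < ∞
  thirdMoment_lt_top : runThirdMoment ψ h ν P < ∞
  variance_original : TendstoInProbability (fun n : ℕ+ => dataLaw P n)
    (fun n x => runVariance h ν (empirical n x)) atTop (runVariance h ν P)
  thirdMoment_original : TendstoInProbability (fun n : ℕ+ => dataLaw P n)
    (fun n x => runThirdMoment ψ h ν (empirical n x)) atTop (runThirdMoment ψ h ν P)
  variance_resample : TendstoInProbability (fun n : ℕ+ => (dataLaw P n).prod (indexLaw n))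
    (fun n xI => runVariance h ν (resampleEmpirical n xI.1 xI.2)) atTop (runVariance h ν P)
  thirdMoment_resample : TendstoInProbability (fun n : ℕ+ => (dataLaw P n).prod (indexLaw n))
    (fun n xI => runThirdMoment ψ h ν (resampleEmpirical n xI.1 xI.2)) atTop
    (runThirdMoment ψ h ν P)

/-! ### The nested experiment and the interval centered at the resample mean -/

/-- Outcomes of the nested experiment: the data, the indices of the `B` resamples, the randomness
of the `R₀` runs for the original estimate, and the randomness of the `R` runs for each of the `B`
resample estimates. -/
abbrev Outcome (𝒳 Ξ : Type*) (B : ℕ) (n : ℕ+) (R₀ R : ℕ) : Type _ :=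
  (Fin n → 𝒳) × (Fin B → Fin n → Fin n) × (Fin R₀ → Ξ) × (Fin B → Fin R → Ξ)

/-- The probability `ℙₙ` of the nested experiment: data, resampling indices and computation
randomness are all independent. -/
def nestedLaw (P : ProbabilityMeasure 𝒳) (ν : Measure Ξ) (B : ℕ) (n : ℕ+) (R₀ R : ℕ) :
    Measure (Outcome 𝒳 Ξ B n R₀ R) :=
  (dataLaw P n).prod ((Measure.pi fun _ : Fin B => indexLaw n).prod
    ((Measure.pi fun _ : Fin R₀ => ν).prod
      (Measure.pi fun _ : Fin B => Measure.pi fun _ : Fin R => ν)))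

variable {B : ℕ} {n : ℕ+} {R₀ R : ℕ}

/-- The original point estimate: the average of `R₀` runs driven by the empirical distribution. -/
def pointEstimate (h : ProbabilityMeasure 𝒳 → Ξ → ℝ) (ω : Outcome 𝒳 Ξ B n R₀ R) : ℝ :=
  (1 / (R₀ : ℝ)) * ∑ r, h (empirical n ω.1) (ω.2.2.1 r)

/-- The `b`-th resample estimate: the average of `R` runs driven by the `b`-th resample empirical
distribution. -/
def resampleEstimate (h : ProbabilityMeasure 𝒳 → Ξ → ℝ) (ω : Outcome 𝒳 Ξ B n R₀ R)
    (b : Fin B) : ℝ :=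
  (1 / (R : ℝ)) * ∑ r, h (resampleEmpirical n ω.1 (ω.2.1 b)) (ω.2.2.2 b r)

/-- The sample mean of the resample estimates. -/
def resampleMean (h : ProbabilityMeasure 𝒳 → Ξ → ℝ) (ω : Outcome 𝒳 Ξ B n R₀ R) : ℝ :=
  (1 / (B : ℝ)) * ∑ b, resampleEstimate h ω b

/-- The sample variance `S_M²` of the resample estimates. -/
def sampleVariance (h : ProbabilityMeasure 𝒳 → Ξ → ℝ) (ω : Outcome 𝒳 Ξ B n R₀ R) : ℝ :=
  (1 / ((B : ℝ) - 1)) * ∑ b, (resampleEstimate h ω b - resampleMean h ω) ^ 2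

/-- The critical value `max{ρ⁻¹, 1} · t_{B-1, 1-α/2}`. -/
def criticalValue (B : ℕ) (ρ α : ℝ) : ℝ :=
  max ρ⁻¹ 1 * quantile (studentT (B - 1)) (1 - α / 2)

/-- The interval centered at the original point estimate, with half-width the critical value times
the sample standard deviation `S_M` of the resample estimates. -/
def meanCenteredInterval (h : ProbabilityMeasure 𝒳 → Ξ → ℝ) (ρ α : ℝ)
    (ω : Outcome 𝒳 Ξ B n R₀ R) : Set ℝ :=
  Set.Icc (pointEstimate h ω - criticalValue B ρ α * √(sampleVariance h ω))
    (pointEstimate h ω + criticalValue B ρ α * √(sampleVariance h ω))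

/-- The coverage probability of the interval for the target `ψ P`. -/
def coverage (P : ProbabilityMeasure 𝒳) (ψ : ProbabilityMeasure 𝒳 → ℝ)
    (h : ProbabilityMeasure 𝒳 → Ξ → ℝ) (ν : Measure Ξ) (B : ℕ) (ρ α : ℝ)
    (n : ℕ+) (R₀ R : ℕ) : ℝ :=
  (nestedLaw P ν B n R₀ R).real {ω | ψ P ∈ meanCenteredInterval h ρ α ω}

end CheapBootstrap

end

/-
The scaled errors of the computed estimates are the errors of the exactly computed ones (sampling
and resampling) plus computation errors. Given the data, the resampling errors are asymptotically
`N(0, σ²)`, and given the data and the resamples, a central limit theorem makes the computation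
errors of the point and resample estimates asymptotically `N(0, τ²/p₀)` and `N(0, τ²/p)`. As these
conditional limits are not random, all the errors become independent: the point estimate has
limiting variance `σ² + τ²/p₀` and each resample estimate `σ² + τ²/p`. Coverage means that the
error of the point estimate is at most the critical value `q` times the sample standard deviation
of the errors of the resample estimates, so its limiting probability is that of `[-t, t]` under
Student's law, where `t = q √(σ² + τ²/p) / √(σ² + τ²/p₀)`. The ratio of the two roots is at least
`1 / max {ρ⁻¹, 1}`, with equality for `ρ = 1`, so `t` is at least the Student quantile.
-/

noncomputable section

namespace CheapBootstrap

lemma integral_le_add_mul_measureReal {Ω : Type*} [MeasurableSpace Ω] {μ : Measure Ω}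
    [IsProbabilityMeasure μ] {g : Ω → ℝ} {C δ : ℝ} (hg : AEMeasurable g μ) (h0 : ∀ ω, 0 ≤ g ω)
    (hC : ∀ ω, g ω ≤ C) (hδ : 0 ≤ δ) : ∫ ω, g ω ∂μ ≤ δ + C * μ.real {ω | ¬g ω < δ} := by
  set A := {ω | ¬g ω < δ}
  have hA : NullMeasurableSet A μ := (nullMeasurableSet_lt hg aemeasurable_const).compl
  have hint : Integrable (A.indicator fun _ => C) μ := (integrable_const C).indicator₀ hA
  have hle (ω) : g ω ≤ δ + A.indicator (fun _ => C) ω := by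
    by_cases hω : ω ∈ A
    · rw [Set.indicator_of_mem hω]
      linarith [hC ω]
    · rw [Set.indicator_of_notMem hω, add_zero]
      exact (not_not.1 hω).le
  calc ∫ ω, g ω ∂μ
    _ ≤ ∫ ω, (δ + A.indicator (fun _ => C) ω) ∂μ :=
      integral_mono_of_nonneg (ae_of_all _ h0) ((integrable_const δ).add hint) (ae_of_all _ hle)
    _ = δ + C * μ.real A := by
      rw [integral_add (integrable_const δ) hint, integral_indicator₀ hA]
      simp [mul_comm]

section HighProbability

variable {ι : Type*} {Ω Ω' : ι → Type*} [∀ i, MeasurableSpace (Ω i)] [∀ i, MeasurableSpace (Ω' i)]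
  {μ : ∀ i, Measure (Ω i)} {μ' : ∀ i, Measure (Ω' i)} {l : Filter ι}

/-- The filter of events whose probability tends to one. It lives on the disjoint union of the
sample spaces, so that convergence in probability of `f i : Ω i → E` is ordinary convergence of
`⟨i, ω⟩ ↦ f i ω` along it, and the whole calculus of limits becomes available. -/
def highProbability (μ : ∀ i, Measure (Ω i)) (l : Filter ι) : Filter (Σ i, Ω i) :=
  Filter.comk (fun A => Tendsto (fun i => μ i {ω | ⟨i, ω⟩ ∈ A}) l (𝓝 0))
    (by simpa using tendsto_const_nhds)
    (fun _ hA _ hsub => tendsto_of_tendsto_of_tendsto_of_le_of_le tendsto_const_nhds hA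
      (fun _ => zero_le) fun _ => measure_mono fun _ hω => hsub hω)
    (fun A hA C hC => tendsto_of_tendsto_of_tendsto_of_le_of_le tendsto_const_nhds
      (by simpa only [add_zero] using hA.add hC) (fun _ => zero_le) fun i =>
        measure_union_le {ω | ⟨i, ω⟩ ∈ A} {ω | ⟨i, ω⟩ ∈ C})

lemma eventually_highProbability {p : (Σ i, Ω i) → Prop} :
    (∀ᶠ a in highProbability μ l, p a) ↔ Tendsto (fun i => μ i {ω | ¬p ⟨i, ω⟩}) l (𝓝 0) :=
  Iff.rfl

lemma tendsto_fst_highProbability : Tendsto Sigma.fst (highProbability μ l) l := by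
  intro s hs
  refine eventually_highProbability.2 (tendsto_const_nhds.congr' ?_)
  filter_upwards [hs] with i hi
  simp [hi]

lemma TendstoInProbability.comp_measurePreserving {E : Type*} [EDist E] {f : ∀ i, Ω' i → E} {c : E}
    (hf : TendstoInProbability μ' f l c) {T : ∀ i, Ω i → Ω' i}
    (hT : ∀ i, MeasurePreserving (T i) (μ i) (μ' i)) :
    TendstoInProbability μ (fun i ω => f i (T i ω)) l c := by
  intro ε hε
  refine tendsto_of_tendsto_of_tendsto_of_le_of_le tendsto_const_nhds (hf ε hε)
    (fun _ => zero_le) fun i => ?_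
  rw [← (hT i).map_eq]
  exact Measure.le_map_apply (hT i).aemeasurable _

lemma TendstoInProbability.tendsto_highProbability {E : Type*} [TopologicalSpace E]
    [m : WeakPseudoEMetricSpace E] {f : ∀ i, Ω i → E} {c : E} (hf : TendstoInProbability μ f l c) :
    Tendsto (fun a => f a.1 a.2) (highProbability μ l) (𝓝 c) := by
  let m' : PseudoEMetricSpace E :=
    { edist_self := m.edist_self, edist_comm := m.edist_comm, edist_triangle := m.edist_triangle }
  refine Tendsto.mono_right ?_ (nhds_mono m.topology_le)
  refine (Metric.nhds_basis_eball (α := E)).tendsto_right_iff.2 fun ε hε => ?_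
  refine eventually_highProbability.2 ?_
  simpa only [Metric.mem_eball, not_lt] using hf ε hε

lemma tendsto_integral_norm_sub_of_tendsto_highProbability {E : Type*} [NormedAddCommGroup E]
    [∀ i, IsProbabilityMeasure (μ i)] {f : ∀ i, Ω i → E} {c : E} {C : ℝ}
    (hf : ∀ i, AEStronglyMeasurable (f i) (μ i)) (hC : ∀ i ω, ‖f i ω‖ ≤ C)
    (hfc : Tendsto (fun a => f a.1 a.2) (highProbability μ l) (𝓝 c)) :
    Tendsto (fun i => ∫ ω, ‖f i ω - c‖ ∂μ i) l (𝓝 0) := by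
  have hm (i) : AEMeasurable (fun ω => ‖f i ω - c‖) (μ i) :=
    ((hf i).sub (aestronglyMeasurable_const (b := c))).norm.aemeasurable
  have hle (i ω) : ‖f i ω - c‖ ≤ C + ‖c‖ := (norm_sub_le _ _).trans (by gcongr; exact hC i ω)
  refine tendsto_order.2 ⟨fun a ha => Eventually.of_forall fun i =>
    ha.trans_le (integral_nonneg fun _ => norm_nonneg _), fun ε hε => ?_⟩
  have bound_tendsto : Tendsto
      (fun i => ε / 2 + (C + ‖c‖) * (μ i).real {ω | ¬‖f i ω - c‖ < ε / 2}) l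
      (𝓝 (ε / 2 + (C + ‖c‖) * 0)) := by
    have hfar := eventually_highProbability.1
      ((tendsto_iff_norm_sub_tendsto_zero.1 hfc).eventually_lt_const (half_pos hε))
    exact (((ENNReal.tendsto_toReal ENNReal.zero_ne_top).comp hfar).const_mul _).const_add _
  filter_upwards [bound_tendsto.eventually_lt_const (u := ε) (by linarith)] with i hi
  exact (integral_le_add_mul_measureReal (hm i) (fun _ => norm_nonneg _) (hle i)
    (half_pos hε).le).trans_lt hi

lemma tendsto_integral_mul_of_tendsto_highProbability {𝕜 : Type*} [RCLike 𝕜]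
    [∀ i, IsProbabilityMeasure (μ i)] {f g : ∀ i, Ω i → 𝕜} {a b : 𝕜} {C D : ℝ}
    (hf : ∀ i, AEStronglyMeasurable (f i) (μ i)) (hC : ∀ i ω, ‖f i ω‖ ≤ C)
    (hg : ∀ i, AEStronglyMeasurable (g i) (μ i)) (hD : ∀ i ω, ‖g i ω‖ ≤ D)
    (hfa : Tendsto (fun i => ∫ ω, f i ω ∂μ i) l (𝓝 a))
    (hgb : Tendsto (fun x => g x.1 x.2) (highProbability μ l) (𝓝 b)) :
    Tendsto (fun i => ∫ ω, f i ω * g i ω ∂μ i) l (𝓝 (a * b)) := by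
  have hfi (i) : Integrable (f i) (μ i) := .of_bound (hf i) C (ae_of_all _ (hC i))
  have hgi (i) : Integrable (fun ω => g i ω - b) (μ i) :=
    (Integrable.of_bound (hg i) D (ae_of_all _ (hD i))).sub (integrable_const b)
  have split (i) : ∫ ω, f i ω * g i ω ∂μ i =
      ∫ ω, f i ω * (g i ω - b) ∂μ i + (∫ ω, f i ω ∂μ i) * b := by
    rw [← integral_mul_const, ← integral_add ((hgi i).bdd_mul (hf i) (ae_of_all _ (hC i)))
      ((hfi i).mul_const b)]
    simp only [mul_sub, sub_add_cancel]
  have remainder : Tendsto (fun i => ∫ ω, f i ω * (g i ω - b) ∂μ i) l (𝓝 0) := by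
    have hL1 := (tendsto_integral_norm_sub_of_tendsto_highProbability hg hD hgb).const_mul C
    rw [mul_zero] at hL1
    refine squeeze_zero_norm (fun i => ?_) hL1
    rw [← integral_const_mul]
    refine norm_integral_le_of_norm_le ((hgi i).norm.const_mul C) (ae_of_all _ fun ω => ?_)
    rw [norm_mul]
    gcongr
    exact hC i ω
  simpa only [split, zero_add] using remainder.add (hfa.mul_const b)

end HighProbability

section WeakConvergence

variable {ι : Type*} {l : Filter ι}

lemma isPiSystem_Ioc_ratCast :
    IsPiSystem (Set.range fun q : ℚ × ℚ => Set.Ioc (q.1 : ℝ) (q.2 : ℝ)) := by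
  rintro _ ⟨⟨a, b⟩, rfl⟩ _ ⟨⟨c, d⟩, rfl⟩ -
  exact ⟨(max a c, min b d), by push_cast; exact Set.Ioc_inter_Ioc.symm⟩

lemma exists_Ioc_ratCast_mem_nhds_subset {u : Set ℝ} (hu : IsOpen u) {x : ℝ} (hx : x ∈ u) :
    ∃ s ∈ Set.range fun q : ℚ × ℚ => Set.Ioc (q.1 : ℝ) (q.2 : ℝ), s ∈ 𝓝 x ∧ s ⊆ u := by
  obtain ⟨ε, hε, hball⟩ := Metric.isOpen_iff.1 hu x hx
  obtain ⟨a, ha, ha'⟩ := exists_rat_btwn (sub_lt_self x hε)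
  obtain ⟨b, hb, hb'⟩ := exists_rat_btwn (lt_add_of_pos_right x hε)
  refine ⟨_, ⟨(a, b), rfl⟩, Ioc_mem_nhds ha' hb, fun y hy => hball ?_⟩
  rw [Real.ball_eq_Ioo]
  exact ⟨ha.trans hy.1, hy.2.trans_lt hb'⟩

lemma measureReal_Ioc_eq_sub_measureReal_Iic (m : Measure ℝ) [IsFiniteMeasure m] (a b : ℝ) :
    m.real (Set.Ioc a b) = m.real (Set.Iic (max a b)) - m.real (Set.Iic a) := by
  have hsub : Set.Iic a ⊆ Set.Iic (max a b) := Set.Iic_subset_Iic.2 (le_max_left a b)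
  rw [← measureReal_sdiff hsub measurableSet_Iic, Set.Iic_sdiff_Iic]
  rcases le_total a b with hab | hab <;> simp [hab]

/- The π-system criterion for weak convergence needs a countably generated filter. Convergence of
the distribution functions at all rationals defines one on the space of probability measures. -/
theorem tendsto_probabilityMeasure_of_tendsto_measureReal_Iic {m : ι → ProbabilityMeasure ℝ}
    {m₀ : ProbabilityMeasure ℝ}
    (hm : ∀ t : ℝ, Tendsto (fun i => (m i : Measure ℝ).real (Set.Iic t)) l
      (𝓝 ((m₀ : Measure ℝ).real (Set.Iic t)))) : Tendsto m l (𝓝 m₀) := by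
  let cdfAt (q : ℚ) (m : ProbabilityMeasure ℝ) : ℝ := (m : Measure ℝ).real (Set.Iic (q : ℝ))
  have tendsto_cdfAt (q : ℚ) : Tendsto (cdfAt q) (⨅ q, comap (cdfAt q) (𝓝 (cdfAt q m₀)))
      (𝓝 (cdfAt q m₀)) := tendsto_iInf' q tendsto_comap
  suffices Tendsto id (⨅ q, comap (cdfAt q) (𝓝 (cdfAt q m₀))) (𝓝 m₀) from
    this.comp (tendsto_iInf.2 fun q => tendsto_comap_iff.2 (hm q))
  refine isPiSystem_Ioc_ratCast.tendsto_probabilityMeasure_of_tendsto_of_mem ?_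
    (fun _ hu _ hx => exists_Ioc_ratCast_mem_nhds_subset hu hx) ?_
  · rintro _ ⟨q, rfl⟩
    exact measurableSet_Ioc
  · rintro _ ⟨⟨a, b⟩, rfl⟩
    have real_eq (m : ProbabilityMeasure ℝ) :
        ((m (Set.Ioc (a : ℝ) b) : ℝ≥0) : ℝ) = cdfAt (max a b) m - cdfAt a m := by
      rw [← ProbabilityMeasure.measureReal_eq_coe_coeFn, measureReal_Ioc_eq_sub_measureReal_Iic]
      simp only [cdfAt, Rat.cast_max]
    simp only [← NNReal.tendsto_coe, real_eq]
    exact (tendsto_cdfAt _).sub (tendsto_cdfAt _)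

variable {E : Type*} [NormedAddCommGroup E] [InnerProductSpace ℝ E] [MeasurableSpace E]
  [BorelSpace E]

lemma tendsto_charFun_of_tendsto_probabilityMeasure [SecondCountableTopology E]
    {m : ι → ProbabilityMeasure E} {m₀ : ProbabilityMeasure E} (hm : Tendsto m l (𝓝 m₀)) (t : E) :
    Tendsto (fun i => charFun (m i) t) l (𝓝 (charFun (m₀ : Measure E) t)) := by
  simp only [charFun_eq_integral_innerProbChar]
  exact (ProbabilityMeasure.tendsto_iff_forall_integral_rclike_tendsto ℂ).1 hm _

theorem tendsto_probabilityMeasure_of_tendsto_charFun [FiniteDimensional ℝ E]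
    [l.IsCountablyGenerated] {m : ι → ProbabilityMeasure E} {m₀ : ProbabilityMeasure E}
    (hm : ∀ t, Tendsto (fun i => charFun (m i) t) l (𝓝 (charFun (m₀ : Measure E) t))) :
    Tendsto m l (𝓝 m₀) :=
  tendsto_of_seq_tendsto fun _ hu =>
    ProbabilityMeasure.tendsto_of_tendsto_charFun fun t => (hm t).comp hu

end WeakConvergence

section CentralLimit

lemma norm_cexp_mul_I_sub_taylor_le (x : ℝ) :
    ‖Complex.exp (x * Complex.I) - (1 + x * Complex.I - (x : ℂ) ^ 2 / 2)‖ ≤ 4 * |x| ^ 3 := by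
  rcases le_total |x| 1 with hx | hx
  · have taylor := Complex.exp_bound (x := x * Complex.I) (by simpa using hx) (n := 3) (by norm_num)
    have sum_eq : ∑ m ∈ Finset.range 3, ((x : ℂ) * Complex.I) ^ m / (m.factorial : ℂ) =
        1 + x * Complex.I - (x : ℂ) ^ 2 / 2 := by
      simp only [Finset.sum_range_succ, Finset.sum_range_zero, mul_pow, Complex.I_sq, Nat.factorial]
      push_cast
      ring
    rw [sum_eq] at taylor
    refine taylor.trans ?_
    rw [norm_mul, Complex.norm_I, mul_one, Complex.norm_real, Real.norm_eq_abs, mul_comm]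
    gcongr
    norm_num [Nat.factorial]
  · have hpoly : ‖1 + x * Complex.I - (x : ℂ) ^ 2 / 2‖ ≤ 1 + |x| + |x| ^ 2 / 2 := by
      refine (norm_sub_le _ _).trans ?_
      gcongr
      · exact (norm_add_le _ _).trans (by simp)
      · simp
    have hx1 : |x| ≤ |x| ^ 3 := le_self_pow₀ hx (by norm_num)
    have hx2 : |x| ^ 2 ≤ |x| ^ 3 := pow_le_pow_right₀ hx (by norm_num)
    refine (norm_sub_le _ _).trans ?_
    rw [Complex.norm_exp_ofReal_mul_I]
    linarith

lemma abs_exp_neg_sub_one_sub_le {y : ℝ} (hy : 0 ≤ y) :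
    |Real.exp (-y) - (1 - y)| ≤ y ^ 2 := by
  rcases le_total y 1 with h1 | h1
  · simpa [sub_sub, sub_eq_add_neg, add_comm, add_assoc] using
      Real.abs_exp_sub_one_sub_id_le (x := -y) (by rwa [abs_neg, abs_of_nonneg hy])
  · rw [abs_of_nonneg (by linarith [Real.add_one_le_exp (-y)])]
    nlinarith [Real.exp_le_one_iff.2 (neg_nonpos.2 hy)]

lemma norm_pow_sub_pow_le_mul_norm_sub {R : Type*} [NormedCommRing R] [NormOneClass R]
    {z w : R} (hz : ‖z‖ ≤ 1) (hw : ‖w‖ ≤ 1) (N : ℕ) : ‖z ^ N - w ^ N‖ ≤ N * ‖z - w‖ := by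
  induction N with
  | zero => simp
  | succ k ih =>
    have hzk : ‖z ^ k‖ ≤ 1 := (norm_pow_le z k).trans (pow_le_one₀ (norm_nonneg z) hz)
    calc ‖z ^ (k + 1) - w ^ (k + 1)‖
      _ = ‖z ^ k * (z - w) + (z ^ k - w ^ k) * w‖ := by congr 1; ring
      _ ≤ ‖z ^ k‖ * ‖z - w‖ + ‖z ^ k - w ^ k‖ * ‖w‖ :=
        (norm_add_le _ _).trans (add_le_add (norm_mul_le _ _) (norm_mul_le _ _))
      _ ≤ 1 * ‖z - w‖ + (k * ‖z - w‖) * 1 := by gcongr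
      _ = (k + 1 : ℕ) * ‖z - w‖ := by push_cast; ring

lemma norm_charFun_sub_taylor_le {μ : Measure ℝ} [IsProbabilityMeasure μ]
    (h3 : MemLp id 3 μ) (h0 : ∫ x, x ∂μ = 0) (u : ℝ) :
    ‖charFun μ u - ((1 - u ^ 2 * (∫ x, x ^ 2 ∂μ) / 2 : ℝ) : ℂ)‖ ≤
      4 * |u| ^ 3 * ∫ x, |x| ^ 3 ∂μ := by
  have i1 : Integrable (fun x : ℝ => x) μ := h3.integrable (by norm_num)
  have i2 : Integrable (fun x : ℝ => x ^ 2) μ := (h3.mono_exponent (by norm_num)).integrable_sq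
  have i3 : Integrable (fun x : ℝ => |x| ^ 3) μ := by
    simpa using h3.integrable_norm_pow (by norm_num)
  have ilin : Integrable (fun x : ℝ => (1 : ℂ) + (u * x : ℝ) * Complex.I) μ :=
    (integrable_const 1).add ((i1.const_mul u).ofReal.mul_const _)
  have isq : Integrable (fun x : ℝ => ((u * x : ℝ) : ℂ) ^ 2 / 2) μ := by
    simp_rw [← Complex.ofReal_pow, mul_pow]
    exact (i2.const_mul _).ofReal.div_const _
  have itaylor : Integrable
      (fun x : ℝ => 1 + (u * x : ℝ) * Complex.I - ((u * x : ℝ) : ℂ) ^ 2 / 2) μ := ilin.sub isq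
  have iexp : Integrable (fun x : ℝ => Complex.exp ((u * x : ℝ) * Complex.I)) μ :=
    .of_bound (by fun_prop) 1 (ae_of_all _ fun x => (Complex.norm_exp_ofReal_mul_I _).le)
  have integral_taylor : ∫ x : ℝ, (1 + (u * x : ℝ) * Complex.I - ((u * x : ℝ) : ℂ) ^ 2 / 2) ∂μ =
      ((1 - u ^ 2 * (∫ x, x ^ 2 ∂μ) / 2 : ℝ) : ℂ) := by
    rw [integral_sub ilin isq, integral_add (integrable_const _)
      ((i1.const_mul u).ofReal.mul_const _), integral_mul_const, integral_div,
      integral_complex_ofReal, integral_const_mul, h0]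
    simp_rw [← Complex.ofReal_pow, mul_pow]
    rw [integral_complex_ofReal, integral_const_mul]
    simp
  rw [charFun_apply_real, ← integral_taylor, ← integral_const_mul]
  simp_rw [← Complex.ofReal_mul]
  rw [← integral_sub iexp itaylor]
  refine norm_integral_le_of_norm_le (i3.const_mul _) (ae_of_all _ fun x => ?_)
  refine (norm_cexp_mul_I_sub_taylor_le (u * x)).trans_eq ?_
  rw [abs_mul]
  ring

lemma norm_charFun_pow_sub_exp_le {μ : Measure ℝ} [IsProbabilityMeasure μ]
    (h3 : MemLp id 3 μ) (h0 : ∫ x, x ∂μ = 0) (u : ℝ) (N : ℕ) :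
    ‖charFun μ u ^ N - (Real.exp (-(N * u ^ 2 * (∫ x, x ^ 2 ∂μ) / 2)) : ℝ)‖ ≤
      N * (4 * |u| ^ 3 * ∫ x, |x| ^ 3 ∂μ + (u ^ 2 * (∫ x, x ^ 2 ∂μ) / 2) ^ 2) := by
  set y := u ^ 2 * (∫ x, x ^ 2 ∂μ) / 2 with hy_def
  have hy : 0 ≤ y := by
    have : 0 ≤ ∫ x, x ^ 2 ∂μ := integral_nonneg fun _ => sq_nonneg _
    positivity
  have exp_eq_pow : ((Real.exp (-(N * u ^ 2 * (∫ x, x ^ 2 ∂μ) / 2)) : ℝ) : ℂ) =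
      ((Real.exp (-y) : ℝ) : ℂ) ^ N := by
    rw [← Complex.ofReal_pow, ← Real.exp_nat_mul, hy_def]
    ring_nf
  have norm_exp_le : ‖((Real.exp (-y) : ℝ) : ℂ)‖ ≤ 1 := by
    rw [Complex.norm_real, Real.norm_eq_abs, Real.abs_exp]
    exact Real.exp_le_one_iff.2 (neg_nonpos.2 hy)
  have one_step : ‖charFun μ u - (Real.exp (-y) : ℝ)‖ ≤ 4 * |u| ^ 3 * ∫ x, |x| ^ 3 ∂μ + y ^ 2 := by
    refine (norm_sub_le_norm_sub_add_norm_sub _ ((1 - y : ℝ) : ℂ) _).trans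
      (add_le_add (norm_charFun_sub_taylor_le h3 h0 u) ?_)
    rw [← Complex.ofReal_sub, Complex.norm_real, Real.norm_eq_abs, abs_sub_comm]
    exact abs_exp_neg_sub_one_sub_le hy
  rw [exp_eq_pow]
  exact (norm_pow_sub_pow_le_mul_norm_sub (norm_charFun_le_one u) norm_exp_le N).trans (by gcongr)

theorem tendsto_charFun_pow {α : Type*} {F : Filter α} {μ : α → Measure ℝ}
    [∀ a, IsProbabilityMeasure (μ a)] {N : α → ℕ} {u : α → ℝ} {v κ θ : ℝ}
    (h3 : ∀ᶠ a in F, MemLp id 3 (μ a)) (h0 : ∀ a, ∫ x, x ∂μ a = 0)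
    (hv : Tendsto (fun a => ∫ x, x ^ 2 ∂μ a) F (𝓝 v))
    (hκ : Tendsto (fun a => ∫ x, |x| ^ 3 ∂μ a) F (𝓝 κ))
    (hu : Tendsto u F (𝓝 0)) (hN : Tendsto (fun a => N a * u a ^ 2) F (𝓝 θ)) :
    Tendsto (fun a => charFun (μ a) (u a) ^ N a) F (𝓝 (Real.exp (-(θ * v / 2)) : ℝ)) := by
  have bound_eq (a : α) : N a * (4 * |u a| ^ 3 * ∫ x, |x| ^ 3 ∂μ a +
      (u a ^ 2 * (∫ x, x ^ 2 ∂μ a) / 2) ^ 2) =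
      4 * (N a * u a ^ 2) * |u a| * ∫ x, |x| ^ 3 ∂μ a +
        (N a * u a ^ 2) * u a ^ 2 * (∫ x, x ^ 2 ∂μ a) ^ 2 / 4 := by
    rw [← sq_abs (u a)]
    ring
  have bound_tendsto : Tendsto (fun a => 4 * (N a * u a ^ 2) * |u a| * ∫ x, |x| ^ 3 ∂μ a +
      (N a * u a ^ 2) * u a ^ 2 * (∫ x, x ^ 2 ∂μ a) ^ 2 / 4) F (𝓝 0) := by
    have := (((hN.const_mul 4).mul hu.abs).mul hκ).add
      (((hN.mul (hu.pow 2)).mul (hv.pow 2)).div_const 4)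
    simpa using this
  have exp_tendsto : Tendsto
      (fun a => ((Real.exp (-(N a * u a ^ 2 * (∫ x, x ^ 2 ∂μ a) / 2)) : ℝ) : ℂ)) F
      (𝓝 (Real.exp (-(θ * v / 2)) : ℝ)) :=
    (Complex.continuous_ofReal.comp Real.continuous_exp).continuousAt.tendsto.comp
      ((hN.mul hv).div_const 2).neg
  refine exp_tendsto.congr_dist (squeeze_zero' ?_ ?_ bound_tendsto)
  · exact Eventually.of_forall fun _ => dist_nonneg
  · filter_upwards [h3] with a ha
    rw [dist_comm, dist_eq_norm, ← bound_eq]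
    exact norm_charFun_pow_sub_exp_le ha (h0 a) (u a) (N a)

end CentralLimit

section SumsAndCoordinates

open scoped RealInnerProductSpace

variable {Ω Ω' E F : Type*} [MeasurableSpace Ω] [MeasurableSpace Ω']
  [NormedAddCommGroup E] [InnerProductSpace ℝ E] [MeasurableSpace E]
  [NormedAddCommGroup F] [InnerProductSpace ℝ F] [MeasurableSpace F]

lemma charFun_map_toLp_prod {μ : Measure Ω} [IsProbabilityMeasure μ] {ν : Measure Ω'}
    [IsProbabilityMeasure ν] {f : Ω → E} {g : Ω' → F} (hf : Measurable f) (hg : Measurable g)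
    (t : WithLp 2 (E × F)) :
    charFun ((μ.prod ν).map fun ω => WithLp.toLp 2 (f ω.1, g ω.2)) t =
      charFun (μ.map f) t.fst * charFun (ν.map g) t.snd := by
  have := Measure.isProbabilityMeasure_map (μ := μ) hf.aemeasurable
  have := Measure.isProbabilityMeasure_map (μ := ν) hg.aemeasurable
  refine Eq.trans ?_ (charFun_prod t)
  have hmap := Measure.map_prod_map μ ν hf hg
  rw [hmap, Measure.map_map (by fun_prop) (by fun_prop)]
  rfl

variable [BorelSpace E] [SecondCountableTopology E] [BorelSpace F] [SecondCountableTopology F]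

lemma charFun_map_apply {μ : Measure Ω} {f : Ω → E} (hf : AEMeasurable f μ) (t : E) :
    charFun (μ.map f) t = ∫ ω, Complex.exp (⟪f ω, t⟫ * Complex.I) ∂μ := by
  rw [charFun_apply, integral_map hf (by fun_prop)]

lemma charFun_map_add {μ : Measure Ω} [IsFiniteMeasure μ] {ν : Measure Ω'} [IsFiniteMeasure ν]
    {U : Ω → E} {W : Ω → Ω' → E} (hU : Measurable U) (hW : Measurable (Function.uncurry W))
    (t : E) :
    charFun ((μ.prod ν).map fun ω => U ω.1 + W ω.1 ω.2) t =
      ∫ x, Complex.exp (⟪U x, t⟫ * Complex.I) * charFun (ν.map (W x)) t ∂μ := by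
  have hsum : Measurable fun ω : Ω × Ω' => U ω.1 + W ω.1 ω.2 := (hU.comp measurable_fst).add hW
  have hint : Integrable
      (fun ω : Ω × Ω' => Complex.exp (⟪U ω.1 + W ω.1 ω.2, t⟫ * Complex.I)) (μ.prod ν) :=
    .of_bound (by fun_prop) 1 (ae_of_all _ fun _ => (Complex.norm_exp_ofReal_mul_I _).le)
  rw [charFun_map_apply hsum.aemeasurable, integral_prod _ hint]
  refine integral_congr_ae (ae_of_all _ fun x => ?_)
  have hWx : Measurable (W x) := hW.of_uncurry_left
  simp only [charFun_map_apply hWx.aemeasurable, ← integral_const_mul, ← Complex.exp_add,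
    ← add_mul, ← Complex.ofReal_add, ← inner_add_left]

/- A conditional Slutsky theorem: if `W` has, given `U`, a limit law not depending on `U`, then `U`
and `W` are asymptotically independent. -/
theorem tendsto_charFun_map_add {ι : Type*} {l : Filter ι} {Ω Ω' : ι → Type*}
    [∀ i, MeasurableSpace (Ω i)] [∀ i, MeasurableSpace (Ω' i)]
    {μ : ∀ i, Measure (Ω i)} [∀ i, IsProbabilityMeasure (μ i)]
    {ν : ∀ i, Measure (Ω' i)} [∀ i, IsProbabilityMeasure (ν i)]
    {U : ∀ i, Ω i → E} {W : ∀ i, Ω i → Ω' i → E} (hU : ∀ i, Measurable (U i))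
    (hW : ∀ i, Measurable (Function.uncurry (W i))) {t : E} {a b : ℂ}
    (ha : Tendsto (fun i => charFun ((μ i).map (U i)) t) l (𝓝 a))
    (hb : Tendsto (fun x : Σ i, Ω i => charFun ((ν x.1).map (W x.1 x.2)) t)
      (highProbability μ l) (𝓝 b)) :
    Tendsto (fun i => charFun (((μ i).prod (ν i)).map fun ω => U i ω.1 + W i ω.1 ω.2) t) l
      (𝓝 (a * b)) := by
  have hWm (i) (x : Ω i) : Measurable (W i x) := (hW i).of_uncurry_left
  have (i) (x : Ω i) : IsProbabilityMeasure ((ν i).map (W i x)) :=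
    Measure.isProbabilityMeasure_map (hWm i x).aemeasurable
  have hφ (i) : Measurable fun x => charFun ((ν i).map (W i x)) t := by
    simp only [charFun_map_apply (hWm i _).aemeasurable]
    have hexp : Measurable fun ω : Ω i × Ω' i => Complex.exp (⟪W i ω.1 ω.2, t⟫ * Complex.I) := by
      have hWi : Measurable fun ω : Ω i × Ω' i => W i ω.1 ω.2 := hW i
      fun_prop
    exact hexp.stronglyMeasurable.integral_prod_right.measurable
  simp only [charFun_map_add (hU _) (hW _)]
  simp only [charFun_map_apply (hU _).aemeasurable] at ha
  exact tendsto_integral_mul_of_tendsto_highProbability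
    (fun i => by have := hU i; fun_prop) (fun i x => (Complex.norm_exp_ofReal_mul_I _).le)
    (fun i => (hφ i).aestronglyMeasurable) (fun i x => norm_charFun_le_one t) ha hb

lemma charFun_map_toLp_fst {μ : Measure Ω} {f : Ω → E} (hf : Measurable f)
    (t : WithLp 2 (E × F)) :
    charFun (μ.map fun ω => WithLp.toLp 2 (f ω, (0 : F))) t = charFun (μ.map f) t.fst := by
  rw [charFun_map_apply (by fun_prop), charFun_map_apply hf.aemeasurable]
  simp [WithLp.prod_inner_apply]

lemma charFun_map_toLp_snd {μ : Measure Ω} {g : Ω → F} (hg : Measurable g)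
    (t : WithLp 2 (E × F)) :
    charFun (μ.map fun ω => WithLp.toLp 2 ((0 : E), g ω)) t = charFun (μ.map g) t.snd := by
  rw [charFun_map_apply (by fun_prop), charFun_map_apply hg.aemeasurable]
  simp [WithLp.prod_inner_apply]

lemma charFun_map_toLp_pi {ι : Type*} [Fintype ι] {Ω : ι → Type*} [∀ i, MeasurableSpace (Ω i)]
    {ν : ∀ i, Measure (Ω i)} [∀ i, IsProbabilityMeasure (ν i)] {g : ∀ i, Ω i → ℝ}
    (hg : ∀ i, Measurable (g i)) (t : EuclideanSpace ℝ ι) :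
    charFun ((Measure.pi ν).map fun ω => WithLp.toLp 2 fun i => g i (ω i)) t =
      ∏ i, charFun ((ν i).map (g i)) (t i) := by
  have (i : ι) : IsProbabilityMeasure ((ν i).map (g i)) :=
    Measure.isProbabilityMeasure_map (hg i).aemeasurable
  rw [← charFun_pi, ← Measure.pi_map_pi (fun i => (hg i).aemeasurable),
    Measure.map_map (by fun_prop) (by fun_prop)]
  rfl

lemma charFun_map_sum_pi {ν : Measure Ω} [IsProbabilityMeasure ν] {g : Ω → ℝ} (hg : Measurable g)
    (N : ℕ) (u : ℝ) :
    charFun ((Measure.pi fun _ : Fin N => ν).map fun ω => ∑ r, g (ω r)) u =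
      charFun (ν.map g) u ^ N := by
  have hsum : Measurable fun ω : Fin N → Ω => ∑ r, g (ω r) := by fun_prop
  rw [charFun_map_apply hsum.aemeasurable, charFun_map_apply hg.aemeasurable]
  simp only [sum_inner, Complex.ofReal_sum, Finset.sum_mul, Complex.exp_sum]
  rw [integral_fintype_prod_eq_pow (fun x => Complex.exp (⟪g x, u⟫ * Complex.I)), Fintype.card_fin]

end SumsAndCoordinates

section ComputationRuns

variable {𝒳 Ξ : Type*} [MeasurableSpace 𝒳] {ψ : ProbabilityMeasure 𝒳 → ℝ}
  {h : ProbabilityMeasure 𝒳 → Ξ → ℝ} {Q : ProbabilityMeasure 𝒳}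

/-- The error of an average of `N` runs driven by `Q`, on the scale `√n` of the sampling error. -/
def averageError (ψ : ProbabilityMeasure 𝒳 → ℝ) (h : ProbabilityMeasure 𝒳 → Ξ → ℝ)
    (Q : ProbabilityMeasure 𝒳) (n : ℕ+) {N : ℕ} (ξ : Fin N → Ξ) : ℝ :=
  √(n : ℝ) * ((1 / (N : ℝ)) * ∑ r, h Q (ξ r) - ψ Q)

lemma averageError_eq_mul_sum {n : ℕ+} {N : ℕ} (hN : N ≠ 0) (ξ : Fin N → Ξ) :
    averageError ψ h Q n ξ = √(n : ℝ) / N * ∑ r, (h Q (ξ r) - ψ Q) := by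
  have : (N : ℝ) ≠ 0 := Nat.cast_ne_zero.2 hN
  simp only [averageError, Finset.sum_sub_distrib, Finset.sum_const, Finset.card_univ,
    Fintype.card_fin, nsmul_eq_mul]
  field_simp

variable [MeasurableSpace Ξ] {ν : Measure Ξ}

/-- The law of the error `h Q ξ - ψ Q` of one computation run driven by `Q`. -/
def runErrorLaw (ψ : ProbabilityMeasure 𝒳 → ℝ) (h : ProbabilityMeasure 𝒳 → Ξ → ℝ) (ν : Measure Ξ)
    (Q : ProbabilityMeasure 𝒳) : Measure ℝ :=
  ν.map fun ξ => h Q ξ - ψ Q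

lemma isProbabilityMeasure_runErrorLaw [IsProbabilityMeasure ν] (hQ : Measurable (h Q)) :
    IsProbabilityMeasure (runErrorLaw ψ h ν Q) :=
  Measure.isProbabilityMeasure_map (hQ.sub_const _).aemeasurable

lemma integral_id_runErrorLaw [IsProbabilityMeasure ν] (hQ : UnbiasedAt ψ h ν Q) :
    ∫ y, y ∂runErrorLaw ψ h ν Q = 0 := by
  rw [runErrorLaw, integral_map (hQ.1.aemeasurable.sub_const _) (by fun_prop),
    integral_sub hQ.1 (integrable_const _), hQ.2]
  simp

lemma integral_sq_runErrorLaw (hQ : UnbiasedAt ψ h ν Q) :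
    ∫ y, y ^ 2 ∂runErrorLaw ψ h ν Q = (runVariance h ν Q).toReal := by
  rw [runErrorLaw, integral_map (hQ.1.aemeasurable.sub_const _) (by fun_prop), ← hQ.2]
  exact (variance_eq_integral hQ.1.aemeasurable).symm

lemma integral_abs_pow_three_runErrorLaw (hQ : Measurable (h Q)) :
    ∫ y, |y| ^ 3 ∂runErrorLaw ψ h ν Q = (runThirdMoment ψ h ν Q).toReal := by
  rw [runErrorLaw, integral_map (hQ.sub_const _).aemeasurable (by fun_prop),
    integral_eq_lintegral_of_nonneg_ae (ae_of_all _ fun _ => by positivity) (by fun_prop),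
    runThirdMoment]
  simp only [← Real.norm_eq_abs, ENNReal.ofReal_pow (norm_nonneg _), ofReal_norm]

lemma memLp_id_runErrorLaw (hQ : Measurable (h Q)) (h3 : runThirdMoment ψ h ν Q ≠ ∞) :
    MemLp id 3 (runErrorLaw ψ h ν Q) := by
  have herr : Measurable fun ξ => h Q ξ - ψ Q := hQ.sub_const _
  rw [runErrorLaw, memLp_map_measure_iff aestronglyMeasurable_id herr.aemeasurable]
  refine ⟨herr.aestronglyMeasurable, ?_⟩
  rw [eLpNorm_lt_top_iff_lintegral_rpow_enorm_lt_top (by norm_num) (by norm_num)]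
  simpa [runThirdMoment, lt_top_iff_ne_top] using h3

lemma measurable_averageError (hQ : Measurable (h Q)) (n : ℕ+) (N : ℕ) :
    Measurable (averageError ψ h Q n : (Fin N → Ξ) → ℝ) := by
  unfold averageError
  fun_prop

lemma charFun_map_averageError [IsProbabilityMeasure ν] (hQ : Measurable (h Q)) {n : ℕ+} {N : ℕ}
    (hN : N ≠ 0) (t : ℝ) :
    charFun ((Measure.pi fun _ : Fin N => ν).map (averageError ψ h Q n)) t =
      charFun (runErrorLaw ψ h ν Q) (√(n : ℝ) / N * t) ^ N := by
  have herr : Measurable fun ξ => h Q ξ - ψ Q := hQ.sub_const _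
  rw [runErrorLaw, ← charFun_map_sum_pi herr, ← charFun_map_mul,
    Measure.map_map (by fun_prop) (by fun_prop)]
  exact congr_arg (fun f => charFun (Measure.map f _) t) (funext (averageError_eq_mul_sum hN))

lemma tendsto_natCast_pnat_atTop : Tendsto (fun n : ℕ+ => (n : ℝ)) atTop atTop :=
  tendsto_natCast_atTop_atTop.comp tendsto_PNat_val_atTop_atTop

section Sizes

variable {N : ℕ+ → ℕ} {p : ℝ}

lemma tendsto_sqrt_div_of_tendsto_div
    (hN : Tendsto (fun n : ℕ+ => (N n : ℝ) / n) atTop (𝓝 p)) (hp : p ≠ 0) :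
    Tendsto (fun n : ℕ+ => √(n : ℝ) / N n) atTop (𝓝 0) := by
  have hsqrt := tendsto_inv_atTop_zero.comp
    (Real.tendsto_sqrt_atTop.comp tendsto_natCast_pnat_atTop)
  have hprod := (hN.inv₀ hp).mul hsqrt
  rw [mul_zero] at hprod
  refine hprod.congr fun n => ?_
  have : 0 < (n : ℝ) := Nat.cast_pos.2 n.pos
  rw [inv_div, Function.comp_apply, Function.comp_apply, div_mul_eq_mul_div, ← div_eq_mul_inv,
    Real.div_sqrt]

lemma tendsto_mul_sq_sqrt_div_of_tendsto_div
    (hN : Tendsto (fun n : ℕ+ => (N n : ℝ) / n) atTop (𝓝 p)) (hp : p ≠ 0) :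
    Tendsto (fun n : ℕ+ => N n * (√(n : ℝ) / N n) ^ 2) atTop (𝓝 p⁻¹) := by
  refine (hN.inv₀ hp).congr fun n => ?_
  rw [inv_div, div_pow, Real.sq_sqrt n.val.cast_nonneg]
  rcases eq_or_ne (N n : ℝ) 0 with h0 | h0
  · simp [h0]
  · field_simp

lemma eventually_ne_zero_of_tendsto_div
    (hN : Tendsto (fun n : ℕ+ => (N n : ℝ) / n) atTop (𝓝 p)) (hp : p ≠ 0) :
    ∀ᶠ n in atTop, N n ≠ 0 := by
  filter_upwards [hN.eventually_ne hp] with n hn h0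
  simp [h0] at hn

end Sizes

theorem tendsto_charFun_averageError [IsProbabilityMeasure ν] {α : Type*} {F : Filter α}
    {Q : α → ProbabilityMeasure 𝒳} {n : α → ℕ+} {N : ℕ+ → ℕ} {v κ p : ℝ≥0}
    (hmeas : ∀ a, Measurable (h (Q a))) (hunb : ∀ a, UnbiasedAt ψ h ν (Q a))
    (hv : Tendsto (fun a => runVariance h ν (Q a)) F (𝓝 v))
    (hκ : Tendsto (fun a => runThirdMoment ψ h ν (Q a)) F (𝓝 κ))
    (hn : Tendsto n F atTop) (hN : Tendsto (fun n : ℕ+ => (N n : ℝ) / n) atTop (𝓝 p))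
    (hp : p ≠ 0) (t : ℝ) :
    Tendsto (fun a => charFun ((Measure.pi fun _ : Fin (N (n a)) => ν).map
      (averageError ψ h (Q a) (n a))) t) F (𝓝 (charFun (gaussianReal 0 (v / p)) t)) := by
  have hp' : (p : ℝ) ≠ 0 := NNReal.coe_ne_zero.2 hp
  have (a : α) : IsProbabilityMeasure (runErrorLaw ψ h ν (Q a)) :=
    isProbabilityMeasure_runErrorLaw (hmeas a)
  have hstep : Tendsto (fun a => √(n a : ℝ) / N (n a) * t) F (𝓝 0) := by
    simpa only [zero_mul, Function.comp_def] using
      ((tendsto_sqrt_div_of_tendsto_div hN hp').comp hn).mul_const t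
  have hscale : Tendsto (fun a => N (n a) * (√(n a : ℝ) / N (n a) * t) ^ 2) F
      (𝓝 ((p : ℝ)⁻¹ * t ^ 2)) := by
    simpa only [mul_pow, ← mul_assoc, Function.comp_def] using
      ((tendsto_mul_sq_sqrt_div_of_tendsto_div hN hp').comp hn).mul_const (t ^ 2)
  have hclt := tendsto_charFun_pow (μ := fun a => runErrorLaw ψ h ν (Q a)) (v := v) (κ := κ)
    ((hκ.eventually_ne ENNReal.coe_ne_top).mono fun a => memLp_id_runErrorLaw (hmeas a))
    (fun a => integral_id_runErrorLaw (hunb a))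
    (by simpa only [integral_sq_runErrorLaw (hunb _), ENNReal.coe_toReal,
      Function.comp_def] using (ENNReal.tendsto_toReal ENNReal.coe_ne_top).comp hv)
    (by simpa only [integral_abs_pow_three_runErrorLaw (hmeas _), ENNReal.coe_toReal,
      Function.comp_def] using (ENNReal.tendsto_toReal ENNReal.coe_ne_top).comp hκ)
    hstep hscale
  have limit_eq : charFun (gaussianReal 0 (v / p)) t =
      (Real.exp (-((p : ℝ)⁻¹ * t ^ 2 * v / 2)) : ℝ) := by
    rw [charFun_gaussianReal]
    push_cast
    congr 1
    ring
  rw [limit_eq]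
  refine hclt.congr' ?_
  filter_upwards [hn.eventually (eventually_ne_zero_of_tendsto_div hN hp')] with a ha
  rw [charFun_map_averageError (hmeas a) ha]

end ComputationRuns

section GaussianErrors

/-- The space of joint errors of a point estimate and `B` resample estimates, with its Euclidean
structure. -/
abbrev ErrorSpace (B : ℕ) : Type :=
  WithLp 2 (ℝ × EuclideanSpace ℝ (Fin B))

/-- The joint law of an `N(0, v₀)` error of the point estimate and `B` errors `N(0, v₁)` of the
resample estimates, all independent. -/
def gaussianErrors (B : ℕ) (v₀ v₁ : ℝ≥0) : ProbabilityMeasure (ErrorSpace B) :=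
  ⟨((gaussianReal 0 v₀).prod (Measure.pi fun _ : Fin B => gaussianReal 0 v₁)).map
    fun zy => WithLp.toLp 2 (zy.1, WithLp.toLp 2 zy.2),
    Measure.isProbabilityMeasure_map (by fun_prop)⟩

lemma charFun_gaussianErrors {B : ℕ} (v₀ v₁ : ℝ≥0) (t : ErrorSpace B) :
    charFun (gaussianErrors B v₀ v₁ : Measure (ErrorSpace B)) t =
      charFun (gaussianReal 0 v₀) t.fst * ∏ b, charFun (gaussianReal 0 v₁) (t.snd b) := by
  have hpi := charFun_map_toLp_pi (ν := fun _ : Fin B => gaussianReal 0 v₁)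
    (fun _ => measurable_id) t.snd
  simp only [Measure.map_id, id] at hpi
  refine (charFun_map_toLp_prod measurable_id (WithLp.measurable_toLp 2 _) t).trans ?_
  rw [Measure.map_id, hpi]

lemma charFun_gaussianErrors_add {B : ℕ} (v₀ v₁ w₀ w₁ : ℝ≥0) (t : ErrorSpace B) :
    charFun (gaussianErrors B (v₀ + w₀) (v₁ + w₁) : Measure (ErrorSpace B)) t =
      charFun (gaussianErrors B v₀ v₁ : Measure (ErrorSpace B)) t *
        charFun (gaussianErrors B w₀ w₁ : Measure (ErrorSpace B)) t := by
  have charFun_add (v w : ℝ≥0) (s : ℝ) : charFun (gaussianReal 0 (v + w)) s =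
      charFun (gaussianReal 0 v) s * charFun (gaussianReal 0 w) s := by
    simpa only [gaussianReal_conv_gaussianReal, add_zero] using
      charFun_conv (μ := gaussianReal 0 v) (ν := gaussianReal 0 w) s
  simp only [charFun_gaussianErrors, charFun_add, Finset.prod_mul_distrib]
  ring

end GaussianErrors

section NestedExperiment

variable {𝒳 Ξ : Type*} [MeasurableSpace 𝒳]
  {P : ProbabilityMeasure 𝒳} {ψ : ProbabilityMeasure 𝒳 → ℝ} {h : ProbabilityMeasure 𝒳 → Ξ → ℝ}
  {n : ℕ+} {B R₀ R : ℕ}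

/-- The scaled sampling error `√n (ψ̂ₙ - ψ)` of the exactly computed estimate. -/
def samplingError (P : ProbabilityMeasure 𝒳) (ψ : ProbabilityMeasure 𝒳 → ℝ) (n : ℕ+)
    (x : Fin n → 𝒳) : ℝ :=
  √(n : ℝ) * (ψ (empirical n x) - ψ P)

/-- The scaled resampling error `√n (ψₙ* - ψ̂ₙ)` of the exactly computed estimate of the resample
with indices `I`. -/
def resamplingError (ψ : ProbabilityMeasure 𝒳 → ℝ) (n : ℕ+) (x : Fin n → 𝒳)
    (I : Fin n → Fin n) : ℝ :=
  √(n : ℝ) * (ψ (resampleEmpirical n x I) - ψ (empirical n x))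

/-- The joint resampling errors of `B` resamples. -/
def resamplingErrors (ψ : ProbabilityMeasure 𝒳 → ℝ) (n : ℕ+) (x : Fin n → 𝒳)
    (I : Fin B → Fin n → Fin n) : EuclideanSpace ℝ (Fin B) :=
  WithLp.toLp 2 fun b => resamplingError ψ n x (I b)

/-- The joint scaled errors of the exactly computed estimates: the sampling error of the point
estimate and the resampling errors of the resample estimates. -/
def exactErrors (P : ProbabilityMeasure 𝒳) (ψ : ProbabilityMeasure 𝒳 → ℝ) (n : ℕ+)
    (xI : (Fin n → 𝒳) × (Fin B → Fin n → Fin n)) : ErrorSpace B :=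
  WithLp.toLp 2 (samplingError P ψ n xI.1, resamplingErrors ψ n xI.1 xI.2)

/-- The scaled errors of the computed estimates relative to the exactly computed ones. -/
def computationErrors (ψ : ProbabilityMeasure 𝒳 → ℝ) (h : ProbabilityMeasure 𝒳 → Ξ → ℝ)
    (xI : (Fin n → 𝒳) × (Fin B → Fin n → Fin n)) (ξ : (Fin R₀ → Ξ) × (Fin B → Fin R → Ξ)) :
    ErrorSpace B :=
  WithLp.toLp 2 (averageError ψ h (empirical n xI.1) n ξ.1,
    WithLp.toLp 2 fun b => averageError ψ h (resampleEmpirical n xI.1 (xI.2 b)) n (ξ.2 b))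

/-- The scaled errors of the computed estimates: of the point estimate relative to the target `ψ`,
and of the resample estimates relative to `ψ̂ₙ`. -/
def estimateErrors (P : ProbabilityMeasure 𝒳) (ψ : ProbabilityMeasure 𝒳 → ℝ)
    (h : ProbabilityMeasure 𝒳 → Ξ → ℝ) (ω : Outcome 𝒳 Ξ B n R₀ R) : ErrorSpace B :=
  WithLp.toLp 2 (√(n : ℝ) * (pointEstimate h ω - ψ P),
    WithLp.toLp 2 fun b => √(n : ℝ) * (resampleEstimate h ω b - ψ (empirical n ω.1)))

lemma estimateErrors_eq_add (ω : Outcome 𝒳 Ξ B n R₀ R) :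
    estimateErrors P ψ h ω =
      exactErrors P ψ n (ω.1, ω.2.1) + computationErrors ψ h (ω.1, ω.2.1) ω.2.2 := by
  simp only [estimateErrors, exactErrors, samplingError, resamplingErrors, resamplingError,
    computationErrors, averageError, pointEstimate, resampleEstimate]
  refine congr_arg (WithLp.toLp 2) (Prod.ext ?_ ?_)
  · simp only [Equiv.toFun_as_coe, WithLp.equiv_apply, Prod.mk_add_mk]
    ring
  · ext b
    simp only [Equiv.toFun_as_coe, WithLp.equiv_apply, Prod.mk_add_mk, PiLp.add_apply]
    ring

variable [MeasurableSpace Ξ] {ν : Measure Ξ}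

lemma measurable_resample {α : Type*} [MeasurableSpace α] {x : α → Fin n → 𝒳}
    {I : α → Fin n → Fin n} (hx : Measurable x) (hI : Measurable I) :
    Measurable fun a i => x a (I a i) := by
  have hresample : Measurable fun xI : (Fin n → 𝒳) × (Fin n → Fin n) => fun i => xI.1 (xI.2 i) :=
    measurable_from_prod_countable_left fun _ =>
      measurable_pi_lambda _ fun _ => measurable_pi_apply _
  exact hresample.comp (hx.prodMk hI)

lemma IsComputation.measurable_run_empirical (hc : IsComputation P ψ h ν) (x : Fin n → 𝒳) :
    Measurable (h (empirical n x)) :=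
  Measurable.of_uncurry_left (f := fun x => h (empirical n x)) (hc.measurable_run n)

lemma IsComputation.measurable_functional [SFinite ν] (hc : IsComputation P ψ h ν) (n : ℕ+) :
    Measurable fun x : Fin n → 𝒳 => ψ (empirical n x) := by
  simp only [← (hc.unbiased_empirical n _).2]
  exact (hc.measurable_run n).stronglyMeasurable.integral_prod_right'.measurable

lemma IsComputation.measurable_samplingError [SFinite ν] (hc : IsComputation P ψ h ν) (n : ℕ+) :
    Measurable (samplingError P ψ n) :=
  ((hc.measurable_functional n).sub_const _).const_mul _

lemma IsComputation.measurable_resamplingErrors [SFinite ν] (hc : IsComputation P ψ h ν) (n : ℕ+)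
    (B : ℕ) : Measurable (Function.uncurry (resamplingErrors ψ n (B := B))) := by
  have hψ := hc.measurable_functional n
  refine (WithLp.measurable_toLp 2 _).comp (measurable_pi_lambda _ fun b => ?_)
  have hresample : Measurable fun xI : (Fin n → 𝒳) × (Fin B → Fin n → Fin n) =>
      fun i => xI.1 (xI.2 b i) := measurable_resample measurable_fst (by fun_prop)
  exact ((hψ.comp hresample).sub (hψ.comp measurable_fst)).const_mul _

lemma IsComputation.measurable_exactErrors [SFinite ν] (hc : IsComputation P ψ h ν) (n : ℕ+)
    (B : ℕ) : Measurable (exactErrors P ψ n (B := B)) :=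
  (WithLp.measurable_toLp 2 _).comp
    (((hc.measurable_samplingError n).comp measurable_fst).prodMk
      (hc.measurable_resamplingErrors n B))

lemma IsComputation.measurable_averageError [SFinite ν] (hc : IsComputation P ψ h ν)
    {α : Type*} [MeasurableSpace α] {x : α → Fin n → 𝒳} {N : ℕ} {ξ : α → Fin N → Ξ}
    (hx : Measurable x) (hξ : Measurable ξ) :
    Measurable fun a => averageError ψ h (empirical n (x a)) n (ξ a) := by
  have hrun (r : Fin N) : Measurable fun a => h (empirical n (x a)) (ξ a r) :=
    (hc.measurable_run n).comp (f := fun a => (x a, ξ a r)) (by fun_prop)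
  exact (((Finset.measurable_fun_sum _ fun r _ => hrun r).const_mul _).sub
    ((hc.measurable_functional n).comp hx)).const_mul _

lemma IsComputation.measurable_computationErrors [SFinite ν] (hc : IsComputation P ψ h ν) (n : ℕ+)
    (B R₀ R : ℕ) : Measurable
      (Function.uncurry (computationErrors ψ h (n := n) (B := B) (R₀ := R₀) (R := R))) :=
  (WithLp.measurable_toLp 2 _).comp
    ((hc.measurable_averageError (by fun_prop) (by fun_prop)).prodMk
      ((WithLp.measurable_toLp 2 _).comp (measurable_pi_lambda _ fun _ =>
        hc.measurable_averageError (measurable_resample (by fun_prop) (by fun_prop))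
          (by fun_prop))))

lemma IsComputation.measurable_estimateErrors [SFinite ν] (hc : IsComputation P ψ h ν) (n : ℕ+)
    (B R₀ R : ℕ) :
    Measurable (estimateErrors P ψ h : Outcome 𝒳 Ξ B n R₀ R → ErrorSpace B) := by
  have hassoc : Measurable fun ω : Outcome 𝒳 Ξ B n R₀ R => ((ω.1, ω.2.1), ω.2.2) := by fun_prop
  have hsum : Measurable fun ω : ((Fin n → 𝒳) × (Fin B → Fin n → Fin n)) ×
      (Fin R₀ → Ξ) × (Fin B → Fin R → Ξ) => exactErrors P ψ n ω.1 + computationErrors ψ h ω.1 ω.2 :=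
    ((hc.measurable_exactErrors n B).comp measurable_fst).add
      (hc.measurable_computationErrors n B R₀ R)
  have hcomp := hsum.comp hassoc
  rw [funext estimateErrors_eq_add]
  exact hcomp

end NestedExperiment

section JointLimit

variable {𝒳 Ξ : Type*} [MeasurableSpace 𝒳] [MeasurableSpace Ξ] {P : ProbabilityMeasure 𝒳}
  {ψ : ProbabilityMeasure 𝒳 → ℝ} {h : ProbabilityMeasure 𝒳 → Ξ → ℝ} {ν : Measure Ξ}
  {B : ℕ} {σ v p₀ p : ℝ≥0} {R₀ R : ℕ+ → ℕ}

/-- The joint law of the data and of the indices of `B` resamples. -/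
def resampledDataLaw (P : ProbabilityMeasure 𝒳) (B : ℕ) (n : ℕ+) :
    Measure ((Fin n → 𝒳) × (Fin B → Fin n → Fin n)) :=
  (dataLaw P n).prod (Measure.pi fun _ => indexLaw n)

instance (n : ℕ+) : IsProbabilityMeasure (resampledDataLaw P B n) := by
  unfold resampledDataLaw; infer_instance

/-- The joint law of the computation randomness of all runs: `R₀` runs for the point estimate and
`R` runs for each of the `B` resample estimates. -/
def runsLaw (ν : Measure Ξ) (B R₀ R : ℕ) : Measure ((Fin R₀ → Ξ) × (Fin B → Fin R → Ξ)) :=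
  (Measure.pi fun _ => ν).prod (Measure.pi fun _ => Measure.pi fun _ => ν)

instance [IsProbabilityMeasure ν] (R₀ R : ℕ) : IsProbabilityMeasure (runsLaw ν B R₀ R) := by
  unfold runsLaw; infer_instance

lemma measurePreserving_fst_resampledDataLaw (n : ℕ+) :
    MeasurePreserving Prod.fst (resampledDataLaw P B n) (dataLaw P n) :=
  measurePreserving_fst

lemma measurePreserving_resample_resampledDataLaw (b : Fin B) (n : ℕ+) :
    MeasurePreserving (fun xI => (xI.1, xI.2 b)) (resampledDataLaw P B n)
      ((dataLaw P n).prod (indexLaw n)) :=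
  (MeasurePreserving.id _).prod (measurePreserving_eval (fun _ : Fin B => indexLaw n) b)

lemma charFun_map_resamplingErrors (n : ℕ+) (x : Fin n → 𝒳) (t : EuclideanSpace ℝ (Fin B)) :
    charFun ((Measure.pi fun _ : Fin B => indexLaw n).map (resamplingErrors ψ n x)) t =
      ∏ b, charFun ((indexLaw n).map (resamplingError ψ n x)) (t b) :=
  charFun_map_toLp_pi (ν := fun _ => indexLaw n) (g := fun _ => resamplingError ψ n x)
    (fun _ => .of_discrete) t

lemma charFun_map_computationErrors [IsProbabilityMeasure ν] (hc : IsComputation P ψ h ν) {n : ℕ+}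
    {R₀ R : ℕ} (xI : (Fin n → 𝒳) × (Fin B → Fin n → Fin n)) (t : ErrorSpace B) :
    charFun ((runsLaw ν B R₀ R).map (computationErrors ψ h xI)) t =
      charFun ((Measure.pi fun _ : Fin R₀ => ν).map (averageError ψ h (empirical n xI.1) n)) t.fst *
        ∏ b, charFun ((Measure.pi fun _ : Fin R => ν).map
          (averageError ψ h (resampleEmpirical n xI.1 (xI.2 b)) n)) (t.snd b) := by
  have hpoint := measurable_averageError (ψ := ψ) (hc.measurable_run_empirical xI.1) n R₀
  have hresample (b : Fin B) :
      Measurable (averageError ψ h (resampleEmpirical n xI.1 (xI.2 b)) n : (Fin R → Ξ) → ℝ) :=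
    measurable_averageError (hc.measurable_run_empirical _) n R
  rw [← charFun_map_toLp_pi (ν := fun _ => Measure.pi fun _ => ν) hresample]
  exact charFun_map_toLp_prod hpoint ((WithLp.measurable_toLp 2 _).comp
    (measurable_pi_lambda _ fun b => (hresample b).comp (measurable_pi_apply b))) t

lemma BootstrapValid.tendsto_charFun_samplingError (hboot : BootstrapValid P ψ σ) (t : ℝ) :
    Tendsto (fun n => charFun ((dataLaw P n).map (samplingError P ψ n)) t) atTop
      (𝓝 (charFun (gaussianReal 0 (σ ^ 2)) t)) := by
  simpa only [ProbabilityMeasure.coe_mk, Measure.map_id, ← samplingError.eq_def] using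
    tendsto_charFun_of_tendsto_probabilityMeasure hboot.original.tendsto t

lemma BootstrapValid.tendsto_charFun_resamplingErrors (hboot : BootstrapValid P ψ σ)
    (t : EuclideanSpace ℝ (Fin B)) :
    Tendsto (fun x : Σ n : ℕ+, (Fin n → 𝒳) => charFun
        ((Measure.pi fun _ : Fin B => indexLaw x.1).map (resamplingErrors ψ x.1 x.2)) t)
      (highProbability (dataLaw P) atTop) (𝓝 (∏ b, charFun (gaussianReal 0 (σ ^ 2)) (t b))) := by
  have hm (x : Σ n : ℕ+, (Fin n → 𝒳)) : Measurable (resamplingError ψ x.1 x.2) := .of_discrete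
  let m (x : Σ n : ℕ+, (Fin n → 𝒳)) : ProbabilityMeasure ℝ :=
    ⟨(indexLaw x.1).map (resamplingError ψ x.1 x.2),
      Measure.isProbabilityMeasure_map (hm x).aemeasurable⟩
  have hlim : Tendsto m (highProbability (dataLaw P) atTop) (𝓝 ⟨gaussianReal 0 (σ ^ 2),
      inferInstance⟩) := by
    refine tendsto_probabilityMeasure_of_tendsto_measureReal_Iic fun s => ?_
    simp only [m, ProbabilityMeasure.coe_mk, map_measureReal_apply (hm _) measurableSet_Iic]
    exact (hboot.resample s).tendsto_highProbability
  simp only [charFun_map_resamplingErrors]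
  exact tendsto_finsetProd _ fun b _ => tendsto_charFun_of_tendsto_probabilityMeasure hlim (t b)

theorem BootstrapValid.tendsto_charFun_exactErrors [SFinite ν] (hc : IsComputation P ψ h ν)
    (hboot : BootstrapValid P ψ σ) (t : ErrorSpace B) :
    Tendsto (fun n : ℕ+ => charFun ((resampledDataLaw P B n).map (exactErrors P ψ n)) t) atTop
      (𝓝 (charFun (gaussianErrors B (σ ^ 2) (σ ^ 2) : Measure (ErrorSpace B)) t)) := by
  have hU (n : ℕ+) := hc.measurable_samplingError n
  have hW (n : ℕ+) := hc.measurable_resamplingErrors n B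
  have split (n : ℕ+) : exactErrors P ψ n = fun xI : (Fin n → 𝒳) × (Fin B → Fin n → Fin n) =>
      WithLp.toLp 2 (samplingError P ψ n xI.1, (0 : EuclideanSpace ℝ (Fin B))) +
        WithLp.toLp 2 ((0 : ℝ), resamplingErrors ψ n xI.1 xI.2) := by
    ext1 xI
    simp only [exactErrors, ← WithLp.toLp_add, Prod.mk_add_mk, add_zero, zero_add]
  simp only [split, charFun_gaussianErrors]
  refine tendsto_charFun_map_add (ν := fun n => Measure.pi fun _ : Fin B => indexLaw n)
    (U := fun n x => WithLp.toLp 2 (samplingError P ψ n x, (0 : EuclideanSpace ℝ (Fin B))))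
    (W := fun n x I => WithLp.toLp 2 ((0 : ℝ), resamplingErrors ψ n x I)) ?_ ?_ ?_ ?_
  · exact fun n => (WithLp.measurable_toLp 2 _).comp ((hU n).prodMk measurable_const)
  · exact fun n => (WithLp.measurable_toLp 2 _).comp (measurable_const.prodMk (hW n))
  · simp only [charFun_map_toLp_fst (hU _)]
    exact hboot.tendsto_charFun_samplingError t.fst
  · simp only [charFun_map_toLp_snd ((hW _).of_uncurry_left)]
    exact hboot.tendsto_charFun_resamplingErrors t.snd

theorem MomentConsistent.tendsto_charFun_computationErrors [IsProbabilityMeasure ν]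
    (hc : IsComputation P ψ h ν) (hmom : MomentConsistent P ψ h ν)
    (hv : runVariance h ν P = v)
    (hR₀ : Tendsto (fun n : ℕ+ => (R₀ n : ℝ) / n) atTop (𝓝 p₀)) (hp₀ : p₀ ≠ 0)
    (hR : Tendsto (fun n : ℕ+ => (R n : ℝ) / n) atTop (𝓝 p)) (hp : p ≠ 0) (t : ErrorSpace B) :
    Tendsto (fun xI : Σ n : ℕ+, (Fin n → 𝒳) × (Fin B → Fin n → Fin n) =>
        charFun ((runsLaw ν B (R₀ xI.1) (R xI.1)).map (computationErrors ψ h xI.2)) t)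
      (highProbability (resampledDataLaw P B) atTop)
      (𝓝 (charFun (gaussianErrors B (v / p₀) (v / p) : Measure (ErrorSpace B)) t)) := by
  obtain ⟨κ, hκ⟩ : ∃ κ : ℝ≥0, runThirdMoment ψ h ν P = κ :=
    ⟨_, (ENNReal.coe_toNNReal hmom.thirdMoment_lt_top.ne).symm⟩
  have to_data := measurePreserving_fst_resampledDataLaw (P := P) (B := B)
  have to_resample (b : Fin B) := measurePreserving_resample_resampledDataLaw (P := P) b
  have hτ₀ := (hmom.variance_original.comp_measurePreserving to_data).tendsto_highProbability
  have hκ₀ := (hmom.thirdMoment_original.comp_measurePreserving to_data).tendsto_highProbability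
  have hτ (b : Fin B) :=
    (hmom.variance_resample.comp_measurePreserving (to_resample b)).tendsto_highProbability
  have hκ' (b : Fin B) :=
    (hmom.thirdMoment_resample.comp_measurePreserving (to_resample b)).tendsto_highProbability
  rw [hv] at hτ₀ hτ
  rw [hκ] at hκ₀ hκ'
  simp only [charFun_map_computationErrors hc, charFun_gaussianErrors]
  refine .mul ?_ (tendsto_finsetProd _ fun b _ => ?_)
  · exact tendsto_charFun_averageError (F := highProbability (resampledDataLaw P B) atTop)
      (n := Sigma.fst) (Q := fun xI => empirical xI.1 xI.2.1)
      (fun xI => hc.measurable_run_empirical xI.2.1)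
      (fun xI => hc.unbiased_empirical xI.1 xI.2.1)
      hτ₀ hκ₀ tendsto_fst_highProbability hR₀ hp₀ t.fst
  · exact tendsto_charFun_averageError (F := highProbability (resampledDataLaw P B) atTop)
      (n := Sigma.fst) (Q := fun xI => resampleEmpirical xI.1 xI.2.1 (xI.2.2 b))
      (fun xI => hc.measurable_run_empirical fun i => xI.2.1 (xI.2.2 b i))
      (fun xI => hc.unbiased_empirical xI.1 fun i => xI.2.1 (xI.2.2 b i))
      (hτ b) (hκ' b) tendsto_fst_highProbability hR hp (t.snd b)

instance [IsProbabilityMeasure ν] (n : ℕ+) (R₀ R : ℕ) :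
    IsProbabilityMeasure (nestedLaw P ν B n R₀ R) := by
  unfold nestedLaw; infer_instance

lemma measurePreserving_prodAssoc_nestedLaw [IsProbabilityMeasure ν] (n : ℕ+) (R₀ R : ℕ) :
    MeasurePreserving MeasurableEquiv.prodAssoc
      ((resampledDataLaw P B n).prod (runsLaw ν B R₀ R)) (nestedLaw P ν B n R₀ R) :=
  measurePreserving_prodAssoc _ _ _

lemma map_estimateErrors_nestedLaw [IsProbabilityMeasure ν] (hc : IsComputation P ψ h ν) (n : ℕ+)
    (B R₀ R : ℕ) :
    (nestedLaw P ν B n R₀ R).map (estimateErrors P ψ h) =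
      ((resampledDataLaw P B n).prod (runsLaw ν B R₀ R)).map fun ω =>
        exactErrors P ψ n ω.1 + computationErrors ψ h ω.1 ω.2 := by
  rw [← (measurePreserving_prodAssoc_nestedLaw n R₀ R).map_eq,
    Measure.map_map (hc.measurable_estimateErrors n B R₀ R) (MeasurableEquiv.measurable _)]
  exact congr_arg (Measure.map · _) (funext fun ω => estimateErrors_eq_add _)

theorem tendstoInDistribution_estimateErrors [IsProbabilityMeasure ν]
    (hc : IsComputation P ψ h ν) (hboot : BootstrapValid P ψ σ) (hmom : MomentConsistent P ψ h ν)
    (hv : runVariance h ν P = v)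
    (hR₀ : Tendsto (fun n : ℕ+ => (R₀ n : ℝ) / n) atTop (𝓝 p₀)) (hp₀ : p₀ ≠ 0)
    (hR : Tendsto (fun n : ℕ+ => (R n : ℝ) / n) atTop (𝓝 p)) (hp : p ≠ 0) :
    TendstoInDistribution
      (fun (n : ℕ+) (ω : Outcome 𝒳 Ξ B n (R₀ n) (R n)) => estimateErrors P ψ h ω) atTop id
      (fun n => nestedLaw P ν B n (R₀ n) (R n))
      (gaussianErrors B (σ ^ 2 + v / p₀) (σ ^ 2 + v / p) : Measure (ErrorSpace B)) where
  forall_aemeasurable n := (hc.measurable_estimateErrors n B (R₀ n) (R n)).aemeasurable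
  tendsto := by
    refine tendsto_probabilityMeasure_of_tendsto_charFun fun t => ?_
    simp only [ProbabilityMeasure.coe_mk, Measure.map_id, charFun_gaussianErrors_add,
      map_estimateErrors_nestedLaw hc]
    exact tendsto_charFun_map_add (μ := resampledDataLaw P B)
      (hc.measurable_exactErrors · B) (hc.measurable_computationErrors · B _ _)
      (hboot.tendsto_charFun_exactErrors hc t)
      (hmom.tendsto_charFun_computationErrors hc hv hR₀ hp₀ hR hp t)

end JointLimit

section Quantile

lemma measureReal_Ici_neg (μ : Measure ℝ) [μ.IsNegInvariant] (t : ℝ) :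
    μ.real (Set.Ici (-t)) = μ.real (Set.Iic t) := by
  rw [measureReal_def, measureReal_def, ← Measure.measure_neg μ (Set.Iic t), Set.neg_Iic]

variable (μ : Measure ℝ) [IsProbabilityMeasure μ]

lemma continuous_cdf [NullSingletonClass μ] : Continuous (cdf μ) := by
  refine continuous_iff_continuousAt.2 fun x => ?_
  have hjump : (cdf μ).measure {x} = 0 := by rw [measure_cdf, measure_singleton]
  rw [StieltjesFunction.measure_singleton, ENNReal.ofReal_eq_zero] at hjump
  rw [(monotone_cdf μ).continuousAt_iff_leftLim_eq_rightLim, StieltjesFunction.rightLim_eq]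
  exact le_antisymm ((monotone_cdf μ).leftLim_le le_rfl) (by linarith)

lemma measureReal_Iic_quantile [NullSingletonClass μ] {p : ℝ} (hp₀ : 0 < p) (hp₁ : p < 1) :
    μ.real (Set.Iic (quantile μ p)) = p := by
  have hc := continuous_cdf μ
  simp only [quantile, ← cdf_eq_real]
  obtain ⟨a, ha⟩ := ((tendsto_cdf_atBot μ).eventually_lt_const hp₀).exists
  have bddBelow : BddBelow {q | p ≤ cdf μ q} :=
    ⟨a, fun q hq => le_of_not_gt fun h => (hq.trans (monotone_cdf μ h.le)).not_gt ha⟩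
  have nonempty : {q | p ≤ cdf μ q}.Nonempty :=
    ((tendsto_cdf_atTop μ).eventually_const_le hp₁).exists
  refine le_antisymm ?_ ((isClosed_le continuous_const hc).csInf_mem nonempty bddBelow)
  refine le_of_tendsto (hc.continuousAt.tendsto.mono_left
    (nhdsWithin_le_nhds (s := Set.Iio (sInf {q | p ≤ cdf μ q})))) ?_
  filter_upwards [self_mem_nhdsWithin] with q hq
  exact le_of_not_ge fun h => (csInf_le bddBelow h).not_gt hq

lemma nonneg_of_half_lt_measureReal_Iic [μ.IsNegInvariant] {t : ℝ}
    (ht : 1 / 2 < μ.real (Set.Iic t)) : 0 ≤ t := by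
  by_contra! hneg
  have hdisj : Disjoint (Set.Iic t) (Set.Ici (-t)) :=
    Set.Iic_disjoint_Ici.2 (by linarith)
  have hunion := measureReal_union (μ := μ) hdisj measurableSet_Ici
  linarith [measureReal_Ici_neg μ t, measureReal_le_one (μ := μ) (s := Set.Iic t ∪ Set.Ici (-t))]

lemma measureReal_Icc_neg [μ.IsNegInvariant] {t : ℝ} (ht : 0 ≤ t) :
    μ.real (Set.Icc (-t) t) = 2 * μ.real (Set.Iic t) - 1 := by
  have hunion : Set.Ici (-t) ∪ Set.Iic t = Set.univ :=
    Set.eq_univ_of_forall fun x => by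
      rcases le_total x t with h | h
      · exact .inr h
      · exact .inl (Set.mem_Ici.2 (by linarith))
  have key := measureReal_union_add_inter (μ := μ) (s := Set.Ici (-t)) (t := Set.Iic t)
    measurableSet_Iic
  rw [hunion, probReal_univ, Set.Ici_inter_Iic, measureReal_Ici_neg] at key
  linarith

variable [NullSingletonClass μ] [μ.IsNegInvariant] {α : ℝ}

lemma quantile_one_sub_half_nonneg (hα₀ : 0 < α) (hα₁ : α < 1) :
    0 ≤ quantile μ (1 - α / 2) := by
  refine nonneg_of_half_lt_measureReal_Iic μ ?_
  rw [measureReal_Iic_quantile μ (by linarith) (by linarith)]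
  linarith

lemma measureReal_Icc_quantile_one_sub_half (hα₀ : 0 < α) (hα₁ : α < 1) :
    μ.real (Set.Icc (-quantile μ (1 - α / 2)) (quantile μ (1 - α / 2))) = 1 - α := by
  rw [measureReal_Icc_neg μ (quantile_one_sub_half_nonneg μ hα₀ hα₁),
    measureReal_Iic_quantile μ (by linarith) (by linarith)]
  ring

end Quantile

section Student

lemma measurable_studentRatio (k : ℕ) :
    Measurable fun zv : ℝ × (Fin k → ℝ) => zv.1 / √((∑ i, zv.2 i ^ 2) / k) := by
  fun_prop

instance (k : ℕ) : IsProbabilityMeasure (studentT k) :=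
  Measure.isProbabilityMeasure_map (measurable_studentRatio k).aemeasurable

instance (k : ℕ) : (studentT k).IsNegInvariant where
  neg_eq_self := by
    have hneg : MeasurePreserving (fun x : ℝ => -x) (gaussianReal 0 1) (gaussianReal 0 1) :=
      ⟨measurable_neg, by rw [gaussianReal_map_neg, neg_zero]⟩
    have hprod := hneg.prod (.id (Measure.pi fun _ : Fin k => gaussianReal 0 1))
    rw [Measure.neg, studentT, Measure.map_map measurable_neg (measurable_studentRatio k)]
    conv_rhs => rw [← hprod.map_eq]
    rw [Measure.map_map (measurable_studentRatio k) hprod.measurable]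
    refine congr_arg (Measure.map · _) (funext fun zv => ?_)
    simp [neg_div]

variable {k : ℕ} [NeZero k]

lemma ae_sqrt_sum_sq_div_pos :
    ∀ᵐ v ∂(Measure.pi fun _ : Fin k => gaussianReal 0 1), 0 < √((∑ i, v i ^ 2) / k) := by
  have := nullSingletonClass_gaussianReal (μ := 0) (v := 1) one_ne_zero
  have hne : ∀ᵐ z ∂gaussianReal 0 1, z ≠ 0 := by simp [ae_iff]
  filter_upwards [(measurePreserving_eval (fun _ : Fin k => gaussianReal 0 1)
    0).quasiMeasurePreserving.ae hne] with v hv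
  have hsum : 0 < ∑ i, v i ^ 2 :=
    Finset.sum_pos' (fun i _ => sq_nonneg _) ⟨0, Finset.mem_univ _, sq_pos_of_ne_zero hv⟩
  exact Real.sqrt_pos.2 (div_pos hsum (Nat.cast_pos.2 (NeZero.pos k)))

instance : NullSingletonClass (studentT k) where
  measure_singleton c := by
    have := nullSingletonClass_gaussianReal (μ := 0) (v := 1) one_ne_zero
    have hm := measurable_studentRatio k (measurableSet_singleton c)
    rw [studentT, Measure.map_apply (measurable_studentRatio k) (measurableSet_singleton c),
      Measure.prod_apply_symm hm,
      lintegral_eq_zero_iff' (measurable_measure_prodMk_right hm).aemeasurable]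
    filter_upwards [ae_sqrt_sum_sq_div_pos] with v hv
    refine measure_mono_null (t := {c * √((∑ i, v i ^ 2) / k)}) (fun z hz => ?_)
      (measure_singleton _)
    exact (div_eq_iff hv.ne').1 hz

end Student

section SampleStandardDeviation

/-- The sample standard deviation of a finite family of real numbers, with Bessel's correction. -/
def sampleStdDev {B : ℕ} (y : Fin B → ℝ) : ℝ :=
  √((1 / ((B : ℝ) - 1)) * ∑ b, (y b - (1 / (B : ℝ)) * ∑ c, y c) ^ 2)

lemma continuous_sampleStdDev {B : ℕ} : Continuous (sampleStdDev : (Fin B → ℝ) → ℝ) := by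
  unfold sampleStdDev
  fun_prop

lemma sampleStdDev_mul_sub {B : ℕ} [NeZero B] (c a : ℝ) (y : Fin B → ℝ) :
    sampleStdDev (fun b => c * (y b - a)) = |c| * sampleStdDev y := by
  have hB : (B : ℝ) ≠ 0 := Nat.cast_ne_zero.2 (NeZero.ne B)
  have centered (b : Fin B) : c * (y b - a) - 1 / B * ∑ d, c * (y d - a) =
      c * (y b - 1 / B * ∑ d, y d) := by
    rw [← Finset.mul_sum, Finset.sum_sub_distrib, Fin.sum_const, nsmul_eq_mul]
    field_simp
    ring
  simp only [sampleStdDev, centered]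
  simp only [mul_pow, ← Finset.mul_sum]
  rw [mul_left_comm, Real.sqrt_mul (sq_nonneg c), Real.sqrt_sq_eq_abs]

/-- The unit vector of `ℝⁿ` all of whose coordinates are equal. -/
def unitDiagonal (n : ℕ) : EuclideanSpace ℝ (Fin n) :=
  WithLp.toLp 2 fun _ => (√n)⁻¹

lemma norm_unitDiagonal {n : ℕ} [NeZero n] : ‖unitDiagonal n‖ = 1 := by
  have hn : (n : ℝ) ≠ 0 := Nat.cast_ne_zero.2 (NeZero.ne n)
  rw [← sq_eq_sq₀ (norm_nonneg _) zero_le_one, EuclideanSpace.real_norm_sq_eq]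
  simp [unitDiagonal, hn]

lemma sampleStdDev_eq_sqrt_norm_sq_sub_inner_sq {k : ℕ} (y : Fin (k + 1) → ℝ) :
    sampleStdDev y =
      √((‖WithLp.toLp 2 y‖ ^ 2 - inner ℝ (unitDiagonal (k + 1)) (WithLp.toLp 2 y) ^ 2) / k) := by
  have hk : (0 : ℝ) ≤ k + 1 := by positivity
  have inner_sq : inner ℝ (unitDiagonal (k + 1)) (WithLp.toLp 2 y) ^ 2 =
      (∑ i, y i) ^ 2 / (k + 1) := by
    simp only [unitDiagonal, PiLp.inner_apply, RCLike.inner_apply, conj_trivial, ← Finset.sum_mul,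
      mul_pow, inv_pow, Nat.cast_add_one, Real.sq_sqrt hk, div_eq_mul_inv]
  have sum_sq : ∑ b, (y b - 1 / (k + 1 : ℝ) * ∑ c, y c) ^ 2 =
      ∑ i, y i ^ 2 - (∑ i, y i) ^ 2 / (k + 1) := by
    simp only [sub_sq, Finset.sum_add_distrib, Finset.sum_sub_distrib, ← Finset.sum_mul,
      ← Finset.mul_sum, Fin.sum_const, nsmul_eq_mul, Nat.cast_add_one]
    field_simp
    ring
  rw [sampleStdDev, inner_sq, EuclideanSpace.real_norm_sq_eq, Nat.cast_add_one,
    add_sub_cancel_right, sum_sq, one_div_mul_eq_div]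

lemma exists_orthonormalBasis_apply_zero_eq {E : Type*} [NormedAddCommGroup E]
    [InnerProductSpace ℝ E] [FiniteDimensional ℝ E] {k : ℕ} (hE : Module.finrank ℝ E = k + 1)
    {e : E} (he : ‖e‖ = 1) : ∃ b : OrthonormalBasis (Fin (k + 1)) ℝ E, b 0 = e := by
  have horth : Orthonormal ℝ (Set.domRestrict {(0 : Fin (k + 1))} fun _ => e) := by
    rw [orthonormal_subsingleton_iff]
    exact fun _ => he
  obtain ⟨b, hb⟩ := horth.exists_orthonormalBasis_extension_of_card_eq (by simpa using hE)
  exact ⟨b, hb 0 rfl⟩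

lemma measurePreserving_tail_pi {k : ℕ} {α : Type*} [MeasurableSpace α] (μ : Measure α)
    [IsProbabilityMeasure μ] :
    MeasurePreserving Fin.tail (Measure.pi fun _ : Fin (k + 1) => μ)
      (Measure.pi fun _ : Fin k => μ) :=
  measurePreserving_snd.comp (measurePreserving_piFinSuccAbove (fun _ : Fin (k + 1) => μ) 0)

-- In an orthonormal basis starting with `e`, the statistic is the sum of the squares of the
-- remaining coordinates.
lemma map_norm_sq_sub_inner_sq_stdGaussian {E : Type*} [NormedAddCommGroup E]
    [InnerProductSpace ℝ E] [FiniteDimensional ℝ E] [MeasurableSpace E] [BorelSpace E] {k : ℕ}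
    (hE : Module.finrank ℝ E = k + 1) {e : E} (he : ‖e‖ = 1) :
    (stdGaussian E).map (fun z => ‖z‖ ^ 2 - inner ℝ e z ^ 2) =
      (Measure.pi fun _ : Fin k => gaussianReal 0 1).map fun v => ∑ i, v i ^ 2 := by
  obtain ⟨b, rfl⟩ := exists_orthonormalBasis_apply_zero_eq hE he
  have coordinates (x : Fin (k + 1) → ℝ) :
      ‖∑ i, x i • b i‖ ^ 2 - inner ℝ (b 0) (∑ i, x i • b i) ^ 2 = ∑ i, Fin.tail x i ^ 2 := by
    rw [b.orthonormal.inner_right_fintype, ← real_inner_self_eq_norm_sq, b.orthonormal.inner_sum,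
      Fin.sum_univ_succ]
    simp only [conj_trivial, ← sq, Fin.tail]
    ring
  rw [stdGaussian_eq_map_pi_orthonormalBasis b, Measure.map_map (by fun_prop) (by fun_prop),
    ← (measurePreserving_tail_pi (k := k) (gaussianReal 0 1)).map_eq,
    Measure.map_map (by fun_prop) (measurePreserving_tail_pi (gaussianReal 0 1)).measurable]
  exact congr_arg (Measure.map · _) (funext coordinates)

lemma map_sampleStdDev_pi_gaussianReal (k : ℕ) :
    (Measure.pi fun _ : Fin (k + 1) => gaussianReal 0 1).map sampleStdDev =
      (Measure.pi fun _ : Fin k => gaussianReal 0 1).map fun v => √((∑ i, v i ^ 2) / k) := by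
  have : Measurable fun s : ℝ => √(s / k) := by fun_prop
  have key := congr_arg (Measure.map fun s => √(s / k))
    (map_norm_sq_sub_inner_sq_stdGaussian (k := k) finrank_euclideanSpace_fin norm_unitDiagonal)
  rw [← map_pi_eq_stdGaussian, Measure.map_map (by fun_prop) (by fun_prop),
    Measure.map_map (by fun_prop) (by fun_prop), Measure.map_map (by fun_prop) (by fun_prop)]
    at key
  rwa [funext sampleStdDev_eq_sqrt_norm_sq_sub_inner_sq]

lemma measureReal_abs_le_mul_sampleStdDev {k : ℕ} [NeZero k] (c : ℝ) :
    ((gaussianReal 0 1).prod (Measure.pi fun _ : Fin (k + 1) => gaussianReal 0 1)).real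
      {zy | |zy.1| ≤ c * sampleStdDev zy.2} = (studentT k).real (Set.Icc (-c) c) := by
  have hdev : Measurable (sampleStdDev : (Fin (k + 1) → ℝ) → ℝ) :=
    continuous_sampleStdDev.measurable
  have hroot : Measurable fun v : Fin k → ℝ => √((∑ i, v i ^ 2) / k) := by fun_prop
  have hA : MeasurableSet {zs : ℝ × ℝ | |zs.1| ≤ c * zs.2} :=
    measurableSet_le (by fun_prop) (by fun_prop)
  have same_law := Measure.map_prod_map (gaussianReal 0 1)
    (Measure.pi fun _ : Fin (k + 1) => gaussianReal 0 1) measurable_id hdev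
  rw [map_sampleStdDev_pi_gaussianReal, Measure.map_prod_map _ _ measurable_id hroot] at same_law
  have same_measure := congr_arg (fun m => m.real {zs : ℝ × ℝ | |zs.1| ≤ c * zs.2}) same_law
  simp only [map_measureReal_apply (measurable_id.prodMap hdev) hA,
    map_measureReal_apply (measurable_id.prodMap hroot) hA] at same_measure
  refine same_measure.symm.trans ?_
  rw [studentT, map_measureReal_apply (measurable_studentRatio k) measurableSet_Icc]
  refine measureReal_congr ?_
  filter_upwards [Measure.quasiMeasurePreserving_snd.ae ae_sqrt_sum_sq_div_pos] with zv hzv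
  refine propext (?_ : |zv.1| ≤ c * √((∑ i, zv.2 i ^ 2) / k) ↔
    zv.1 / √((∑ i, zv.2 i ^ 2) / k) ∈ Set.Icc (-c) c)
  rw [Set.mem_Icc, ← abs_le, abs_div, abs_of_pos hzv, div_le_iff₀ hzv]

end SampleStandardDeviation

section CoverageRegion

variable {B : ℕ}

/-- The set of joint errors for which the error of the point estimate is at most `c` sample standard
deviations of the errors of the resample estimates. -/
def coverageRegion (B : ℕ) (c : ℝ) : Set (ErrorSpace B) :=
  {w | |w.fst| ≤ c * sampleStdDev w.snd.ofLp}

lemma continuous_abs_fst : Continuous fun w : ErrorSpace B => |w.fst| := by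
  fun_prop

lemma continuous_mul_sampleStdDev_snd (c : ℝ) :
    Continuous fun w : ErrorSpace B => c * sampleStdDev w.snd.ofLp :=
  (continuous_sampleStdDev.comp (by fun_prop)).const_mul c

lemma measurableSet_coverageRegion (c : ℝ) : MeasurableSet (coverageRegion B c) :=
  (isClosed_le continuous_abs_fst (continuous_mul_sampleStdDev_snd c)).measurableSet

lemma measure_prod_abs_fst_eq {β : Type*} [MeasurableSpace β] (μ : Measure ℝ) [SFinite μ]
    [NullSingletonClass μ] (ν : Measure β) [SFinite ν] {f : β → ℝ} (hf : Measurable f) :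
    (μ.prod ν) {zy | |zy.1| = f zy.2} = 0 := by
  have hset : MeasurableSet {zy : ℝ × β | |zy.1| = f zy.2} :=
    measurableSet_eq_fun (by fun_prop) (by fun_prop)
  rw [Measure.prod_apply_symm hset]
  refine (lintegral_congr fun y => ?_).trans lintegral_zero
  refine measure_mono_null (t := {f y, -f y}) (fun z (hz : |z| = f y) => ?_)
    ((Set.toFinite _).measure_zero _)
  exact eq_or_eq_neg_of_abs_eq hz

lemma gaussianErrors_frontier_coverageRegion (c : ℝ) {v₀ : ℝ≥0} (hv₀ : v₀ ≠ 0) (v₁ : ℝ≥0) :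
    (gaussianErrors B v₀ v₁ : Measure (ErrorSpace B)) (frontier (coverageRegion B c)) = 0 := by
  have := nullSingletonClass_gaussianReal (μ := 0) hv₀
  refine measure_mono_null
    (frontier_le_subset_eq continuous_abs_fst (continuous_mul_sampleStdDev_snd c)) ?_
  have hset : MeasurableSet {w : ErrorSpace B | |w.fst| = c * sampleStdDev w.snd.ofLp} :=
    (isClosed_eq continuous_abs_fst (continuous_mul_sampleStdDev_snd c)).measurableSet
  rw [gaussianErrors, ProbabilityMeasure.coe_mk, Measure.map_apply (by fun_prop) hset]
  exact measure_prod_abs_fst_eq _ _ (continuous_sampleStdDev.measurable.const_mul c)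

lemma measurePreserving_sqrt_mul_gaussianReal (v : ℝ≥0) :
    MeasurePreserving (√(v : ℝ) * ·) (gaussianReal 0 1) (gaussianReal 0 v) := by
  refine ⟨measurable_const_mul _, ?_⟩
  rw [gaussianReal_map_const_mul, mul_zero]
  congr 1
  ext
  simp

lemma gaussianErrors_real_coverageRegion {k : ℕ} [NeZero k] (c : ℝ) {v₀ : ℝ≥0} (hv₀ : v₀ ≠ 0)
    (v₁ : ℝ≥0) :
    (gaussianErrors (k + 1) v₀ v₁ : Measure (ErrorSpace (k + 1))).real (coverageRegion (k + 1) c) =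
      (studentT k).real (Set.Icc (-(c * √v₁ / √v₀)) (c * √v₁ / √v₀)) := by
  have hpos : 0 < √(v₀ : ℝ) := Real.sqrt_pos.2 (NNReal.coe_pos.2 (pos_iff_ne_zero.2 hv₀))
  have hset : MeasurableSet {zy : ℝ × (Fin (k + 1) → ℝ) | |zy.1| ≤ c * sampleStdDev zy.2} :=
    measurableSet_le (by fun_prop)
      ((continuous_sampleStdDev.measurable.comp measurable_snd).const_mul c)
  have standardize := (measurePreserving_sqrt_mul_gaussianReal v₀).prod
    (measurePreserving_pi (fun _ : Fin (k + 1) => gaussianReal 0 1) (fun _ => gaussianReal 0 v₁)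
      fun _ => measurePreserving_sqrt_mul_gaussianReal v₁)
  have scaled (z : ℝ) (y : Fin (k + 1) → ℝ) :
      |√(v₀ : ℝ) * z| ≤ c * sampleStdDev (fun b => √(v₁ : ℝ) * y b) ↔
        |z| ≤ c * √v₁ / √v₀ * sampleStdDev y := by
    have hdev := sampleStdDev_mul_sub √(v₁ : ℝ) 0 y
    simp only [sub_zero, abs_of_nonneg (Real.sqrt_nonneg _)] at hdev
    rw [hdev, abs_mul, abs_of_pos hpos, div_mul_eq_mul_div, le_div_iff₀ hpos, mul_comm |z|,
      mul_assoc c]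
  rw [← measureReal_abs_le_mul_sampleStdDev, gaussianErrors, ProbabilityMeasure.coe_mk,
    map_measureReal_apply (by fun_prop) (measurableSet_coverageRegion c)]
  refine (standardize.measureReal_preimage hset.nullMeasurableSet).symm.trans ?_
  exact congr_arg _ (Set.ext fun zy => scaled zy.1 zy.2)

end CoverageRegion

section Coverage

variable {𝒳 Ξ : Type*} [MeasurableSpace 𝒳] {P : ProbabilityMeasure 𝒳}
  {ψ : ProbabilityMeasure 𝒳 → ℝ} {h : ProbabilityMeasure 𝒳 → Ξ → ℝ}

lemma mem_meanCenteredInterval_iff {B : ℕ} [NeZero B] {n : ℕ+} {R₀ R : ℕ} (ρ α : ℝ)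
    (ω : Outcome 𝒳 Ξ B n R₀ R) :
    ψ P ∈ meanCenteredInterval h ρ α ω ↔
      estimateErrors P ψ h ω ∈ coverageRegion B (criticalValue B ρ α) := by
  have hpos : 0 < √(n : ℝ) := Real.sqrt_pos.2 (Nat.cast_pos.2 n.pos)
  have hdev : √(sampleVariance h ω) = sampleStdDev (resampleEstimate h ω) := rfl
  change _ ↔ |√(n : ℝ) * (pointEstimate h ω - ψ P)| ≤ criticalValue B ρ α *
    sampleStdDev fun b => √(n : ℝ) * (resampleEstimate h ω b - ψ (empirical n ω.1))
  rw [sampleStdDev_mul_sub, abs_mul, abs_of_pos hpos, mul_left_comm, mul_le_mul_iff_right₀ hpos,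
    meanCenteredInterval, hdev, ← Real.closedBall_eq_Icc, Metric.mem_closedBall', Real.dist_eq]

variable [MeasurableSpace Ξ] {ν : Measure Ξ} [IsProbabilityMeasure ν]

lemma coverage_eq_map_real (hc : IsComputation P ψ h ν) (B : ℕ) [NeZero B] (ρ α : ℝ) (n : ℕ+)
    (R₀ R : ℕ) :
    coverage P ψ h ν B ρ α n R₀ R =
      ((nestedLaw P ν B n R₀ R).map (estimateErrors P ψ h)).real
        (coverageRegion B (criticalValue B ρ α)) := by
  rw [map_measureReal_apply (hc.measurable_estimateErrors n B R₀ R)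
    (measurableSet_coverageRegion _), coverage]
  exact congr_arg _ (Set.ext fun ω => mem_meanCenteredInterval_iff ρ α ω)

theorem tendsto_coverage_gaussianErrors (hc : IsComputation P ψ h ν) {σ : ℝ≥0}
    (hboot : BootstrapValid P ψ σ) (hmom : MomentConsistent P ψ h ν) {v : ℝ≥0}
    (hv : runVariance h ν P = v) {R₀ R : ℕ+ → ℕ} {p₀ p : ℝ≥0}
    (hR₀ : Tendsto (fun n : ℕ+ => (R₀ n : ℝ) / n) atTop (𝓝 p₀)) (hp₀ : p₀ ≠ 0)
    (hR : Tendsto (fun n : ℕ+ => (R n : ℝ) / n) atTop (𝓝 p)) (hp : p ≠ 0) (B : ℕ) [NeZero B]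
    (ρ α : ℝ) :
    Tendsto (fun n : ℕ+ => coverage P ψ h ν B ρ α n (R₀ n) (R n)) atTop
      (𝓝 ((gaussianErrors B (σ ^ 2 + v / p₀) (σ ^ 2 + v / p) : Measure (ErrorSpace B)).real
        (coverageRegion B (criticalValue B ρ α)))) := by
  have hv₀ : v ≠ 0 := by
    rintro rfl
    exact hmom.variance_pos.ne' hv
  have null_frontier : ((gaussianErrors B (σ ^ 2 + v / p₀) (σ ^ 2 + v / p) :
      Measure (ErrorSpace B)).map id) (frontier (coverageRegion B (criticalValue B ρ α))) = 0 := by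
    rw [Measure.map_id]
    exact gaussianErrors_frontier_coverageRegion _ (by positivity) _
  have key := ProbabilityMeasure.tendsto_measure_of_null_frontier_of_tendsto'
    (tendstoInDistribution_estimateErrors hc hboot hmom hv hR₀ hp₀ hR hp).tendsto null_frontier
  rw [ProbabilityMeasure.coe_mk, Measure.map_id] at key
  simp only [coverage_eq_map_real hc]
  exact (ENNReal.tendsto_toReal (measure_ne_top _ _)).comp key

lemma sqrt_add_div_le_max_mul_sqrt_add_div {s v p₀ p : ℝ} (hs : 0 ≤ s) (hv : 0 ≤ v)
    (hp₀ : 0 < p₀) (hp : 0 < p) :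
    √(s + v / p₀) ≤ max (√(p₀ / p))⁻¹ 1 * √(s + v / p) := by
  have hmax : max (√(p₀ / p))⁻¹ 1 = √(max (p / p₀) 1) := by
    rw [(Monotone.map_max fun _ _ => Real.sqrt_le_sqrt : √(max (p / p₀) 1) = _), ← Real.sqrt_inv,
      inv_div, Real.sqrt_one]
  rw [hmax, ← Real.sqrt_mul (by positivity)]
  refine Real.sqrt_le_sqrt ?_
  calc s + v / p₀ = 1 * s + p / p₀ * (v / p) := by field_simp
    _ ≤ max (p / p₀) 1 * s + max (p / p₀) 1 * (v / p) := by
      gcongr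
      exacts [le_max_right _ _, le_max_left _ _]
    _ = max (p / p₀) 1 * (s + v / p) := by ring

lemma quantile_le_criticalValue_mul_sqrt_div_sqrt {k : ℕ} [NeZero k] {s v p₀ p α : ℝ} (hs : 0 ≤ s)
    (hv : 0 < v) (hp₀ : 0 < p₀) (hp : 0 < p) (hα₀ : 0 < α) (hα₁ : α < 1) :
    quantile (studentT k) (1 - α / 2) ≤
      criticalValue (k + 1) √(p₀ / p) α * √(s + v / p) / √(s + v / p₀) := by
  have ht := quantile_one_sub_half_nonneg (studentT k) hα₀ hα₁
  rw [criticalValue, Nat.add_sub_cancel, le_div_iff₀ (Real.sqrt_pos.2 (by positivity)), mul_comm,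
    mul_right_comm]
  exact mul_le_mul_of_nonneg_right (sqrt_add_div_le_max_mul_sqrt_add_div hs hv.le hp₀ hp) ht

theorem tendsto_coverage_studentT (hc : IsComputation P ψ h ν) {σ : ℝ≥0}
    (hboot : BootstrapValid P ψ σ) (hmom : MomentConsistent P ψ h ν) {v : ℝ}
    (hv : (runVariance h ν P).toReal = v) {R₀ R : ℕ+ → ℕ} {p₀ p : ℝ}
    (hR₀ : Tendsto (fun n : ℕ+ => (R₀ n : ℝ) / n) atTop (𝓝 p₀)) (hp₀ : 0 < p₀)
    (hR : Tendsto (fun n : ℕ+ => (R n : ℝ) / n) atTop (𝓝 p)) (hp : 0 < p) (k : ℕ) [NeZero k]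
    (ρ α : ℝ) :
    Tendsto (fun n : ℕ+ => coverage P ψ h ν (k + 1) ρ α n (R₀ n) (R n)) atTop
      (𝓝 ((studentT k).real (Set.Icc
        (-(criticalValue (k + 1) ρ α * √(σ ^ 2 + v / p) / √(σ ^ 2 + v / p₀)))
        (criticalValue (k + 1) ρ α * √(σ ^ 2 + v / p) / √(σ ^ 2 + v / p₀))))) := by
  lift p₀ to ℝ≥0 using hp₀.le
  lift p to ℝ≥0 using hp.le
  lift v to ℝ≥0 using hv ▸ ENNReal.toReal_nonneg
  have hv' : runVariance h ν P = v := by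
    rw [← ENNReal.ofReal_coe_nnreal, ← hv, ENNReal.ofReal_toReal hmom.variance_lt_top.ne]
  have hv₀ : v ≠ 0 := by
    rintro rfl
    exact hmom.variance_pos.ne' hv'
  rw [NNReal.coe_pos] at hp₀ hp
  have key := tendsto_coverage_gaussianErrors hc hboot hmom hv' hR₀ hp₀.ne' hR hp.ne' (k + 1) ρ α
  rw [gaussianErrors_real_coverageRegion _ (by positivity)] at key
  exact_mod_cast key

end Coverage

end CheapBootstrap

end

open CheapBootstrap in
theorem theorem5_general {𝒳 Ξ : Type*} [MeasurableSpace 𝒳] [MeasurableSpace Ξ]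
    (P : ProbabilityMeasure 𝒳) (ψ : ProbabilityMeasure 𝒳 → ℝ)
    (h : ProbabilityMeasure 𝒳 → Ξ → ℝ) (ν : Measure Ξ) [IsProbabilityMeasure ν]
    (hcomp : IsComputation P ψ h ν) (σ : ℝ≥0) (hboot : BootstrapValid P ψ σ)
    (hmom : MomentConsistent P ψ h ν) (R₀ R : ℕ+ → ℕ) (p₀ p : ℝ) (hp₀ : 0 < p₀) (hp : 0 < p)
    (hR₀ : Tendsto (fun n : ℕ+ => (R₀ n : ℝ) / (n : ℝ)) atTop (𝓝 p₀))
    (hR : Tendsto (fun n : ℕ+ => (R n : ℝ) / (n : ℝ)) atTop (𝓝 p))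
    (B : ℕ) (hB : 2 ≤ B) (α : ℝ) (hα₀ : 0 < α) (hα₁ : α < 1) (ρ : ℝ) (hρ : ρ = √(p₀ / p)) :
    1 - α ≤ liminf (fun n : ℕ+ => coverage P ψ h ν B ρ α n (R₀ n) (R n)) atTop ∧
    (ρ = 1 →
      Tendsto (fun n : ℕ+ => coverage P ψ h ν B ρ α n (R₀ n) (R n)) atTop (𝓝 (1 - α))) := by
  obtain ⟨k, rfl⟩ : ∃ k, B = k + 1 := ⟨B - 1, by omega⟩
  have : NeZero k := ⟨by omega⟩
  have hv := ENNReal.toReal_pos hmom.variance_pos.ne' hmom.variance_lt_top.ne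
  have hlim := tendsto_coverage_studentT hcomp hboot hmom rfl hR₀ hp₀ hR hp k ρ α
  have hlevel := measureReal_Icc_quantile_one_sub_half (studentT k) hα₀ hα₁
  constructor
  · have hle := quantile_le_criticalValue_mul_sqrt_div_sqrt (k := k) (sq_nonneg (σ : ℝ)) hv hp₀ hp
      hα₀ hα₁
    rw [hlim.liminf_eq, ← hlevel, hρ]
    exact measureReal_mono (Set.Icc_subset_Icc (neg_le_neg hle) hle)
  · rintro rfl
    have hpp : p₀ = p := by
      rwa [eq_comm, Real.sqrt_eq_one, div_eq_one_iff_eq hp.ne'] at hρ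
    subst hpp
    have hpos : 0 < √((σ : ℝ) ^ 2 + (runVariance h ν P).toReal / p₀) :=
      Real.sqrt_pos.2 (by positivity)
    rwa [criticalValue, inv_one, max_self, one_mul, mul_div_cancel_right₀ _ hpos.ne',
      Nat.add_sub_cancel, hlevel] at hlim

open CheapBootstrap in
theorem theorem5 {𝒳 Ξ : Type*} [MeasurableSpace 𝒳] [MeasurableSpace Ξ]
    (P : ProbabilityMeasure 𝒳) (ψ : ProbabilityMeasure 𝒳 → ℝ)
    (h : ProbabilityMeasure 𝒳 → Ξ → ℝ) (ν : Measure Ξ) [IsProbabilityMeasure ν]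
    (hcomp : IsComputation P ψ h ν)
    (σ : ℝ≥0) (hσ : 0 < σ) (hboot : BootstrapValid P ψ σ)
    (hmom : MomentConsistent P ψ h ν)
    (R₀ R : ℕ+ → ℕ) (p₀ p : ℝ) (hp₀ : 0 < p₀) (hp₀' : p₀ < 1) (hp : 0 < p) (hp' : p < 1)
    (hR₀ : Tendsto (fun n : ℕ+ => (R₀ n : ℝ) / (n : ℝ)) atTop (𝓝 p₀))
    (hR : Tendsto (fun n : ℕ+ => (R n : ℝ) / (n : ℝ)) atTop (𝓝 p))
    (B : ℕ) (hB : 2 ≤ B) (α : ℝ) (hα₀ : 0 < α) (hα₁ : α < 1)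
    (ρ : ℝ) (hρ : ρ = √(p₀ / p)) :
    1 - α ≤ liminf (fun n : ℕ+ => coverage P ψ h ν B ρ α n (R₀ n) (R n)) atTop ∧
    (ρ = 1 →
      Tendsto (fun n : ℕ+ => coverage P ψ h ν B ρ α n (R₀ n) (R n)) atTop (𝓝 (1 - α))) :=
  theorem5_general P ψ h ν hcomp σ hboot hmom R₀ R p₀ p hp₀ hp hR₀ hR B hB α hα₀ hα₁ ρ hρ
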